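/- Let $\sigma_{d-1}$ be the usual surface measure on the unit sphere $\mathbb{S}^{d-1}\subset\mathbb{R}^d$, and let $\omega_{d-1}=\sigma_{d-1}(\mathbb{S}^{d-1})$. For $f\in L^2(\mathbb{S}^{d-1})$ put $$\widehat{f\sigma}_{d-1}(x)=\int_{\mathbb{S}^{d-1}} f(\omega)\,e^{-i x\cdot\omega}\,d\sigma_{d-1}(\omega)\quad(x\in\mathbb{R}^d),\qquad \Phi_{d,q}(f)=\frac{\|\widehat{f\sigma}_{d-1}\|_{L^q(\mathbb{R}^d)}^q}{\|f\|_{L^2(\mathbb{S}^{d-1})}^q}\quad(f\neq 0),$$ and let $\gamma_d(q)=\omega_{d-1}\dfrac{1+q}{2d+q-\delta_{d,4}}$, where $\delta_{d,4}=1$ if $d=4$ and $\delta_{d,4}=0$ otherwise. Write $\mathbf{1}$ for the constant function $1$ on $\mathbb{S}^{d-1}$. Set $q_\star(2)=12$ and $q_\star(d)=8$ for $d\in\{3,4,5,6,7\}$. Proposition. Let $d\in\{2,3,4,5,6,7\}$. Then, for every real number $q\geq q_\star(d)$, the quantities $\Phi_{d,q}(\mathbf{1})$ and $\Phi_{d,q+2}(\mathbf{1})$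 are finite and $$\Phi_{d,q+2}(\mathbf{1})>\gamma_d(q)\,\Phi_{d,q}(\mathbf{1}).$$ -/

import Mathlib

open MeasureTheory
open scoped ENNReal RealInnerProductSpace

noncomputable section

namespace SphereExtension

/-- The unit sphere `S^{d-1}` of the Euclidean space `ℝ^d`. -/
abbrev UnitSphere (d : ℕ) : Type :=
  Metric.sphere (0 : EuclideanSpace ℝ (Fin d)) 1

/-- The surface measure `σ_{d-1}` on `S^{d-1}`, normalized so that polar coordinates read
`dx = r^{d-1} dr dσ_{d-1}(ω)`; its total mass is `2 π^{d/2} / Γ(d/2)`. -/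
def surfaceMeasure (d : ℕ) : Measure (UnitSphere d) :=
  (volume : Measure (EuclideanSpace ℝ (Fin d))).toSphere

instance surfaceMeasure_isFiniteMeasure (d : ℕ) : IsFiniteMeasure (surfaceMeasure d) := by
  unfold surfaceMeasure
  infer_instance

/-- `ω_{d-1} = σ_{d-1}(S^{d-1})`. -/
def sphereArea (d : ℕ) : ℝ :=
  (surfaceMeasure d).real Set.univ

/-- The Fourier extension operator: the Fourier transform of the measure `f σ_{d-1}`,
`x ↦ ∫ f(ω) e^{-i x·ω} dσ_{d-1}(ω)`. -/
def extension (d : ℕ) (f : Lp ℂ 2 (surfaceMeasure d)) (x : EuclideanSpace ℝ (Fin d)) : ℂ :=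
  ∫ ω : UnitSphere d,
    f ω * Complex.exp (-(Complex.I * ((⟪x, (ω : EuclideanSpace ℝ (Fin d))⟫ : ℝ) : ℂ)))
      ∂(surfaceMeasure d)

/-- The functional `Φ_{d,q}(f) = ‖(f σ_{d-1})^‖_{L^q(ℝ^d)}^q / ‖f‖_{L²(S^{d-1})}^q`.
It is the intended real number when the extension of `f` lies in `L^q(ℝ^d)`. -/
def Phi (d : ℕ) (q : ℝ) (f : Lp ℂ 2 (surfaceMeasure d)) : ℝ :=
  (eLpNorm (extension d f) (ENNReal.ofReal q) volume).toReal ^ q / ‖f‖ ^ q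

/-- The constant function `1` as an element of `L²(S^{d-1})`. -/
def one (d : ℕ) : Lp ℂ 2 (surfaceMeasure d) :=
  Lp.const 2 (surfaceMeasure d) (1 : ℂ)

/-- `γ_d(q) = ω_{d-1} (1 + q) / (2 d + q - δ_{d,4})`, with the Kronecker delta `δ`. -/
def gam (d : ℕ) (q : ℝ) : ℝ :=
  sphereArea d * ((1 + q) / (2 * (d : ℝ) + q - (if d = 4 then 1 else 0)))

/-- The threshold: `q_⋆(2) = 12`, and `q_⋆(d) = 8` for `d = 3, …, 7`. -/
def qStar (d : ℕ) : ℝ :=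
  if d = 2 then 12 else 8

end SphereExtension

end

/-!
For `f = 1` the extension is radial, `x ↦ ω_{d-1} u(‖x‖)` with
`u(r) = Γ(d/2) (2/r)^{d/2-1} J_{d/2-1}(r) = normBessel d (r²)` (`extension_one`: the exponential is
expanded and integrated against the moments of the sphere, which are read off from Gaussian
integrals). Since `-Δu = u`, integration by parts gives `∫ |u|^{q+2} = (q+1) ∫ |u|^q |∇u|²`
(`integral_radial_rpow_add_two`), and the assertion becomes (`Phi_one_lt_of_integral_pos`)

  `∫_0^∞ |u|^q (A u'² - 1) r^{d-1} dr > 0`, with `A = 2d + q - δ_{d,4}`.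

Near `0` the integrand is negative, because `u'(0) = 0`. There the derivative of
`d⁻¹ r^d (1 - r²/R²) u^q`, which integrates to zero over `[0, R]`, is added; the new integrand is
`d⁻² r^{d+1} u^{q-1} E` with `E = u (A v² - κ) - q (1 - r²/R²) v`, where
`v = normBessel (d+2) (r²)`, `u' = -(r/d) v` and `κ = d(d+2)/R²`, and `R` can be chosen so that
`E ≥ 0`
(`integral_radialIntegrand_core`). On a further interval `[R, S]` one has `A u'² ≥ 1`, so the
integrand itself is nonnegative. Beyond `S` it is at least `-|u|^q r^{d-1}`. This loss is estimated
by a uniform bound of `|u|` on `[S, T]` and by a decay estimate on `[T, ∞)`, which follows from the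
monotonicity of a quadratic expression in `u` and `u'` (`sq_mul_radial_sq_le` for `d ≥ 3`,
Sonin's function in `mul_radial_two_sq_le` for `d = 2`).

The growth of `A` with `q` only helps, and if `|u| ≤ m` on `[S, ∞)` while the gain is taken from a
set where `u ≥ m`, then gain and loss both scale like `m^{q-p}` as `q` grows from `p = q_⋆(d)`
(`integral_radialIntegrand_pos`). Hence everything reduces to inequalities for `u` and `v` at
`q = p`, one set for each dimension. These are obtained from the partial sums of the power series,
which bound `normBessel d` alternately from above and from below on all of `[0, ∞)`
(`besselPartial_sign`); the resulting polynomial inequalities in `s = r²` on intervals `[a, b]` are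
certified by nonnegative coefficients in the Bernstein basis `(s - a)^i (b - s)^j`.
-/

namespace SphereExtension

/-! ### The normalized Bessel function -/

/-- The coefficient `c_k = ∏_{j<k} 1 / ((2j+2)(d+2j))` of the normalized Bessel function. -/
noncomputable def besselCoeff (d k : ℕ) : ℝ :=
  ∏ j ∈ Finset.range k, (1 / ((2 * (j : ℝ) + 2) * ((d : ℝ) + 2 * j)))

/-- The normalized Bessel function of dimension `d` as a function of `s = r²`:
`normBessel d (r²) = Γ(d/2) (2/r)^{d/2-1} J_{d/2-1}(r)`, given by its power series. -/
noncomputable def normBessel (d : ℕ) (s : ℝ) : ℝ :=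
  ∑' k : ℕ, (-1) ^ k * besselCoeff d k * s ^ k

/-- The partial sum with `n` terms of the series of `normBessel d`. -/
noncomputable def besselPartial (d n : ℕ) (s : ℝ) : ℝ :=
  ∑ k ∈ Finset.range n, (-1) ^ k * besselCoeff d k * s ^ k

lemma besselCoeff_nonneg (d k : ℕ) : 0 ≤ besselCoeff d k :=
  Finset.prod_nonneg fun _ _ => by positivity

lemma besselCoeff_le {d : ℕ} (hd : 1 ≤ d) (k : ℕ) : besselCoeff d k ≤ 1 / (k.factorial : ℝ) := by
  induction k with
  | zero => simp [besselCoeff]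
  | succ k ih =>
    have hd' : (1 : ℝ) ≤ d := by exact_mod_cast hd
    rw [besselCoeff, Finset.prod_range_succ, ← besselCoeff, Nat.factorial_succ]
    push_cast
    rw [mul_comm ((k : ℝ) + 1), ← one_div_mul_one_div (k.factorial : ℝ)]
    refine mul_le_mul ih ?_ (by positivity) (by positivity)
    apply one_div_le_one_div_of_le (by positivity)
    nlinarith [(Nat.cast_nonneg k : (0 : ℝ) ≤ k)]

lemma besselCoeff_succ {d : ℕ} (hd : 1 ≤ d) (k : ℕ) :
    ((k : ℝ) + 1) * besselCoeff d (k + 1) = 1 / (2 * d) * besselCoeff (d + 2) k := by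
  have hd' : (1 : ℝ) ≤ d := by exact_mod_cast hd
  induction k with
  | zero => simp [besselCoeff]
  | succ k ih =>
    have h1 : besselCoeff d (k + 1 + 1) = besselCoeff d (k + 1) *
        (1 / ((2 * ((k + 1 : ℕ) : ℝ) + 2) * ((d : ℝ) + 2 * ((k + 1 : ℕ) : ℝ)))) := by
      rw [besselCoeff, Finset.prod_range_succ, ← besselCoeff]
    have h2 : besselCoeff (d + 2) (k + 1) = besselCoeff (d + 2) k *
        (1 / ((2 * (k : ℝ) + 2) * (((d + 2 : ℕ) : ℝ) + 2 * (k : ℝ)))) := by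
      rw [besselCoeff, Finset.prod_range_succ, ← besselCoeff]
    have h3 : besselCoeff d (k + 1) = 1 / (2 * d) * besselCoeff (d + 2) k / (k + 1) := by
      rw [← ih]; field_simp
    rw [h1, h2, h3]
    push_cast
    have : (d : ℝ) + 2 + 2 * k ≠ 0 := by positivity
    have : (d : ℝ) + 2 * (k + 1) ≠ 0 := by positivity
    field_simp
    ring

lemma summable_normBessel {d : ℕ} (hd : 1 ≤ d) (s : ℝ) :
    Summable fun k : ℕ => (-1) ^ k * besselCoeff d k * s ^ k := by
  refine Summable.of_norm_bounded (Real.summable_pow_div_factorial |s|) fun k => ?_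
  rw [norm_mul, norm_mul, norm_pow, norm_neg, norm_one, one_pow, one_mul, norm_pow,
    Real.norm_of_nonneg (besselCoeff_nonneg d k), Real.norm_eq_abs, div_eq_mul_one_div, mul_comm]
  exact mul_le_mul_of_nonneg_left (besselCoeff_le hd k) (by positivity)

@[simp] lemma normBessel_zero (d : ℕ) : normBessel d 0 = 1 := by
  rw [normBessel, tsum_eq_single 0]
  · simp [besselCoeff]
  · intro k hk
    simp [hk]

/-- Termwise differentiation of the series: `d/ds` shifts the dimension by two. -/
lemma hasDerivAt_normBessel {d : ℕ} (hd : 1 ≤ d) (s : ℝ) :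
    HasDerivAt (normBessel d) (-(1 / (2 * d)) * normBessel (d + 2) s) s := by
  set R : ℝ := |s| + 1
  have hR : 0 < R := by positivity
  have hs : s ∈ Metric.ball (0 : ℝ) R := by simp [R]
  have key := hasDerivAt_tsum_of_isPreconnected
    (g := fun (k : ℕ) (y : ℝ) => (-1) ^ k * besselCoeff d k * y ^ k)
    (g' := fun (k : ℕ) (y : ℝ) => (-1) ^ k * besselCoeff d k * (k * y ^ (k - 1)))
    (u := fun k : ℕ => (R ^ (k - 1) / ((k - 1).factorial : ℝ)))
    (t := Metric.ball (0 : ℝ) R) (y₀ := 0)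
    ((summable_nat_add_iff 1).1 (by simpa using Real.summable_pow_div_factorial R))
    Metric.isOpen_ball (convex_ball _ _).isPreconnected
    (fun k y _ => (hasDerivAt_pow k y).const_mul _)
    (fun k y hy => by
      have hy' : |y| ≤ R := by simpa using (mem_ball_zero_iff.1 hy).le
      rw [norm_mul, norm_mul, norm_pow, norm_neg, norm_one, one_pow, one_mul, norm_mul, norm_pow,
        Real.norm_of_nonneg (besselCoeff_nonneg d k), Real.norm_eq_abs, Real.norm_eq_abs]
      rcases k with _ | k
      · simp
      · calc besselCoeff d (k + 1) * (|((k + 1 : ℕ) : ℝ)| * |y| ^ (k + 1 - 1))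
            ≤ 1 / ((k + 1).factorial : ℝ) * (((k + 1 : ℕ) : ℝ) * R ^ k) := by
              rw [Nat.abs_cast, Nat.add_sub_cancel]
              gcongr
              exact besselCoeff_le hd _
          _ = R ^ (k + 1 - 1) / ((k + 1 - 1).factorial : ℝ) := by
              rw [Nat.add_sub_cancel, Nat.factorial_succ]
              push_cast
              field_simp)
    (Metric.mem_ball_self hR) (summable_normBessel hd 0) hs
  refine key.congr_deriv ?_
  have hsum : Summable fun k : ℕ => (-1) ^ k * besselCoeff d k * (k * s ^ (k - 1)) := by
    refine (summable_nat_add_iff 1).1 ?_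
    refine ((summable_normBessel (d := d + 2) (by omega) s).mul_left (-(1 / (2 * (d : ℝ))))).congr
      fun k => ?_
    have := besselCoeff_succ hd k
    push_cast
    rw [pow_succ]
    linear_combination (-1) ^ k * s ^ k * this
  rw [hsum.tsum_eq_zero_add, normBessel, ← tsum_mul_left]
  simp only [Nat.cast_zero, zero_mul, mul_zero, zero_add]
  refine tsum_congr fun k => ?_
  have := besselCoeff_succ hd k
  push_cast
  rw [pow_succ]
  linear_combination -(-1) ^ k * s ^ k * this

/-- The three-term recurrence, equivalent to Bessel's differential equation. -/
lemma normBessel_recurrence {d : ℕ} (hd : 1 ≤ d) (s : ℝ) :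
    normBessel d s =
      normBessel (d + 2) s - s / (d * (d + 2)) * normBessel (d + 4) s := by
  have hd' : (1 : ℝ) ≤ d := by exact_mod_cast hd
  have h2 := summable_normBessel (d := d + 2) (by omega) s
  have h4 := summable_normBessel (d := d + 4) (by omega) s
  have h0 := summable_normBessel hd s
  rw [normBessel, normBessel, normBessel, h0.tsum_eq_zero_add, h2.tsum_eq_zero_add, ← tsum_mul_left]
  rw [add_sub_assoc, ← ((summable_nat_add_iff 1).2 h2).tsum_sub (h4.mul_left _)]
  congr 1
  refine tsum_congr fun k => ?_
  have e1 := besselCoeff_succ hd k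
  have e2 := besselCoeff_succ (d := d + 2) (by omega) k
  have e3 : besselCoeff (d + 2) (k + 1) = besselCoeff (d + 2) k *
      (1 / ((2 * (k : ℝ) + 2) * (((d + 2 : ℕ) : ℝ) + 2 * (k : ℝ)))) := by
    rw [besselCoeff, Finset.prod_range_succ, ← besselCoeff]
  have e2' : besselCoeff (d + 4) k =
      2 * (d + 2) * (((k : ℝ) + 1) * besselCoeff (d + 2) (k + 1)) := by
    rw [e2]; push_cast; field_simp
  have e1' : besselCoeff d (k + 1) = 1 / (2 * d) * besselCoeff (d + 2) k / (k + 1) := by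
    rw [← e1]; field_simp
  rw [e2', e1', e3]
  push_cast
  have : (d : ℝ) + 2 + 2 * k ≠ 0 := by positivity
  field_simp
  ring

lemma continuous_normBessel {d : ℕ} (hd : 1 ≤ d) : Continuous (normBessel d) :=
  continuous_iff_continuousAt.2 fun s => (hasDerivAt_normBessel hd s).continuousAt

/-- The derivative of `r ↦ normBessel d (r²)`. -/
lemma hasDerivAt_radial {d : ℕ} (hd : 1 ≤ d) (r : ℝ) :
    HasDerivAt (fun r : ℝ => normBessel d (r ^ 2)) (-(r / d) * normBessel (d + 2) (r ^ 2)) r := by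
  have h := (hasDerivAt_normBessel hd (r ^ 2)).comp r (hasDerivAt_pow 2 r)
  refine h.congr_deriv ?_
  have hd' : (1 : ℝ) ≤ d := by exact_mod_cast hd
  push_cast
  field_simp

/-- Bessel's equation as a first-order system: the derivative of `r ↦ normBessel (d+2) (r²)`. -/
lemma hasDerivAt_radial_shift {d : ℕ} (hd : 1 ≤ d) {r : ℝ} (hr : r ≠ 0) :
    HasDerivAt (fun r : ℝ => normBessel (d + 2) (r ^ 2))
      (d / r * (normBessel d (r ^ 2) - normBessel (d + 2) (r ^ 2))) r := by
  refine (hasDerivAt_radial (d := d + 2) (by omega) r).congr_deriv ?_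
  have hd' : (1 : ℝ) ≤ d := by exact_mod_cast hd
  rw [normBessel_recurrence hd]
  push_cast
  field_simp
  ring

lemma continuous_radial {d : ℕ} (hd : 1 ≤ d) : Continuous fun r : ℝ => normBessel d (r ^ 2) :=
  (continuous_normBessel hd).comp (continuous_pow 2)

/-- A function continuous on `[a, ∞)` with nonpositive derivative on `(a, ∞)` is antitone there. -/
lemma antitoneOn_Ici_of_hasDerivAt {f f' : ℝ → ℝ} {a : ℝ} (hc : ContinuousOn f (Set.Ici a))
    (hf : ∀ r, a < r → HasDerivAt f (f' r) r) (hf' : ∀ r, a < r → f' r ≤ 0) :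
    AntitoneOn f (Set.Ici a) := by
  refine antitoneOn_of_deriv_nonpos (convex_Ici a) hc ?_ ?_
  · intro r hr
    rw [interior_Ici] at hr
    exact (hf r hr).differentiableAt.differentiableWithinAt
  · intro r hr
    rw [interior_Ici] at hr
    rw [(hf r hr).deriv]
    exact hf' r hr

/-- The energy `u² + u'²` of a solution of Bessel's equation decreases from its value `1` at `0`. -/
lemma energy_le_one {d : ℕ} (hd : 1 ≤ d) {r : ℝ} (hr : 0 ≤ r) :
    normBessel d (r ^ 2) ^ 2 + (r / d * normBessel (d + 2) (r ^ 2)) ^ 2 ≤ 1 := by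
  have hd' : (1 : ℝ) ≤ d := by exact_mod_cast hd
  have hcu := continuous_radial hd
  have hcv := continuous_radial (d := d + 2) (by omega)
  have := antitoneOn_Ici_of_hasDerivAt (a := 0)
    (f := fun r => normBessel d (r ^ 2) ^ 2 + (r / d * normBessel (d + 2) (r ^ 2)) ^ 2)
    (f' := fun r => -(2 * (d - 1) * r / d ^ 2 * normBessel (d + 2) (r ^ 2) ^ 2))
    (by fun_prop)
    (fun r hr => by
      have h1 := hasDerivAt_radial hd r
      have h2 := hasDerivAt_radial_shift hd hr.ne'
      refine ((h1.pow 2).add ((((hasDerivAt_id r).div_const (d : ℝ)).mul h2).pow 2)).congr_deriv ?_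
      have := hr.ne'
      simp
      field_simp
      ring)
    (fun r hr => by
      have : 0 ≤ 2 * ((d : ℝ) - 1) * r / d ^ 2 * normBessel (d + 2) (r ^ 2) ^ 2 := by
        have : 0 ≤ (d : ℝ) - 1 := by linarith
        positivity
      linarith)
  simpa using this (Set.mem_Ici.2 le_rfl) (Set.mem_Ici.2 hr) hr

lemma abs_radial_le_one {d : ℕ} (hd : 1 ≤ d) {r : ℝ} (hr : 0 ≤ r) :
    |normBessel d (r ^ 2)| ≤ 1 := by
  have := energy_le_one hd hr
  exact abs_le_one_iff_mul_self_le_one.2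
    (by nlinarith [sq_nonneg (r / d * normBessel (d + 2) (r ^ 2))])

lemma normBessel_le_one {d : ℕ} (hd : 1 ≤ d) {s : ℝ} (hs : 0 ≤ s) : normBessel d s ≤ 1 := by
  have := abs_radial_le_one hd (Real.sqrt_nonneg s)
  rw [Real.sq_sqrt hs] at this
  exact (abs_le.1 this).2

lemma hasDerivAt_besselPartial {d : ℕ} (hd : 1 ≤ d) (n : ℕ) (s : ℝ) :
    HasDerivAt (besselPartial d (n + 1)) (-(1 / (2 * d)) * besselPartial (d + 2) n s) s := by
  have h : HasDerivAt (besselPartial d (n + 1)) (∑ k ∈ Finset.range (n + 1),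
      (-1) ^ k * besselCoeff d k * (k * s ^ (k - 1))) s := by
    unfold besselPartial
    exact HasDerivAt.fun_sum fun k _ => (hasDerivAt_pow k s).const_mul _
  refine h.congr_deriv ?_
  rw [Finset.sum_range_succ', besselPartial, Finset.mul_sum]
  simp only [Nat.cast_zero, zero_mul, mul_zero, add_zero]
  refine Finset.sum_congr rfl fun k _ => ?_
  have := besselCoeff_succ hd k
  push_cast
  rw [pow_succ]
  linear_combination -(-1) ^ k * s ^ k * this

@[simp] lemma besselPartial_succ_zero (d n : ℕ) : besselPartial d (n + 1) 0 = 1 := by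
  rw [besselPartial, Finset.sum_range_succ']
  simp [besselCoeff]

/-- The partial sums of the alternating series bound the function alternately from above and from
below, for all `s ≥ 0`: each bound follows from the previous one, two dimensions higher, by
integration. -/
lemma besselPartial_sign (n : ℕ) : ∀ {d : ℕ}, 1 ≤ d → ∀ {s : ℝ}, 0 ≤ s →
    0 ≤ (-1) ^ n * (besselPartial d (n + 1) s - normBessel d s) := by
  induction n with
  | zero =>
    intro d hd s hs
    simpa [besselPartial, besselCoeff] using normBessel_le_one hd hs
  | succ n ih =>
    intro d hd s hs
    have hd' : (1 : ℝ) ≤ d := by exact_mod_cast hd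
    have hder : ∀ r, HasDerivAt (fun s => -((-1) ^ (n + 1) * (besselPartial d (n + 1 + 1) s -
        normBessel d s))) (-((-1) ^ (n + 1) * (-(1 / (2 * d)) * besselPartial (d + 2) (n + 1) r -
          -(1 / (2 * d)) * normBessel (d + 2) r))) r := fun r =>
      (((hasDerivAt_besselPartial hd (n + 1) r).sub (hasDerivAt_normBessel hd r)).const_mul _).neg
    have := antitoneOn_Ici_of_hasDerivAt (a := 0)
      (continuousOn_of_forall_continuousAt fun r _ => (hder r).continuousAt)
      (fun r _ => hder r) (fun r hr => by
        have h := ih (d := d + 2) (by omega) hr.le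
        have h2 : 0 ≤ 1 / (2 * (d : ℝ)) := by positivity
        have := mul_nonneg h2 h
        rw [pow_succ]
        linarith)
    simpa using this (Set.mem_Ici.2 le_rfl) (Set.mem_Ici.2 hs) hs

lemma besselPartial_le_normBessel (n : ℕ) {d : ℕ} (hd : 1 ≤ d) {s : ℝ} (hs : 0 ≤ s) :
    besselPartial d (2 * n + 2) s ≤ normBessel d s := by
  have := besselPartial_sign (2 * n + 1) hd hs
  rw [pow_succ, pow_mul] at this
  norm_num at this
  linarith

lemma normBessel_le_besselPartial (n : ℕ) {d : ℕ} (hd : 1 ≤ d) {s : ℝ} (hs : 0 ≤ s) :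
    normBessel d s ≤ besselPartial d (2 * n + 1) s := by
  have := besselPartial_sign (2 * n) hd hs
  rw [pow_mul] at this
  norm_num at this
  linarith

/-! ### The Fourier transform of the surface measure -/

/-- Integration in polar coordinates of a function homogeneous up to a radial factor. -/
lemma integral_polar {d : ℕ} (hd : 1 ≤ d) (n : ℕ) (g : EuclideanSpace ℝ (Fin d) → ℝ) (φ : ℝ → ℝ)
    (hg : ∀ r : ℝ, 0 < r → ∀ y, g (r • y) = r ^ n * g y) :
    ∫ y : EuclideanSpace ℝ (Fin d), g y * φ ‖y‖ =
      (∫ ω : UnitSphere d, g ω ∂surfaceMeasure d) *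
        ∫ r in Set.Ioi (0 : ℝ), r ^ (n + (d - 1)) * φ r := by
  have : Nonempty (Fin d) := ⟨⟨0, hd⟩⟩
  have : Nontrivial (EuclideanSpace ℝ (Fin d)) := inferInstance
  have hdim : Module.finrank ℝ (EuclideanSpace ℝ (Fin d)) = d := by simp
  have hmp :=
    (volume : Measure (EuclideanSpace ℝ (Fin d))).measurePreserving_homeomorphUnitSphereProd
  rw [hdim] at hmp
  calc ∫ y : EuclideanSpace ℝ (Fin d), g y * φ ‖y‖
      = ∫ y : ({0}ᶜ : Set (EuclideanSpace ℝ (Fin d))), g y * φ ‖(y : EuclideanSpace ℝ (Fin d))‖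
          ∂((volume : Measure (EuclideanSpace ℝ (Fin d))).comap
            ((↑) : ({0}ᶜ : Set (EuclideanSpace ℝ (Fin d))) → EuclideanSpace ℝ (Fin d))) := by
        rw [integral_subtype_comap (measurableSet_singleton _).compl fun y => g y * φ ‖y‖,
          restrict_compl_singleton]
    _ = ∫ p, g p.1 * ((p.2 : ℝ) ^ n * φ p.2)
          ∂((surfaceMeasure d).prod (.volumeIoiPow (d - 1))) := by
        rw [surfaceMeasure, ← hmp.integral_comp (Homeomorph.measurableEmbedding _)]
        refine integral_congr_ae (Filter.Eventually.of_forall fun y => ?_)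
        have hy : 0 < ‖(y : EuclideanSpace ℝ (Fin d))‖ := norm_pos_iff.2 y.2
        have : g y = ‖(y : EuclideanSpace ℝ (Fin d))‖ ^ n *
            g (‖(y : EuclideanSpace ℝ (Fin d))‖⁻¹ • (y : EuclideanSpace ℝ (Fin d))) := by
          rw [← hg _ hy, smul_smul, mul_inv_cancel₀ hy.ne', one_smul]
        simp only [homeomorphUnitSphereProd_apply_fst_coe, homeomorphUnitSphereProd_apply_snd_coe]
        rw [this]
        ring
    _ = (∫ ω : UnitSphere d, g ω ∂surfaceMeasure d) *
          ∫ r : Set.Ioi (0 : ℝ), (r : ℝ) ^ n * φ r ∂(Measure.volumeIoiPow (d - 1)) :=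
        integral_prod_mul (fun ω : UnitSphere d => g ω) fun r : Set.Ioi (0 : ℝ) => (r : ℝ) ^ n * φ r
    _ = _ := by
        congr 1
        simp only [Measure.volumeIoiPow, ENNReal.ofReal]
        rw [integral_withDensity_eq_integral_smul,
          integral_subtype_comap measurableSet_Ioi
            fun a : ℝ => Real.toNNReal (a ^ (d - 1)) • (a ^ n * φ a)]
        · refine setIntegral_congr_fun measurableSet_Ioi fun x hx => ?_
          rw [NNReal.smul_def, Real.coe_toNNReal _ (pow_nonneg (le_of_lt hx) _), smul_eq_mul]
          ring
        · exact (measurable_subtype_coe.pow_const _).real_toNNReal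

lemma integral_Ioi_pow_mul_exp_neg_sq (n : ℕ) :
    ∫ r in Set.Ioi (0 : ℝ), r ^ n * Real.exp (-r ^ 2) = 1 / 2 * Real.Gamma (((n : ℝ) + 1) / 2) := by
  have := integral_rpow_mul_exp_neg_rpow (p := 2) (q := n) two_pos
    (by linarith [(Nat.cast_nonneg n : (0 : ℝ) ≤ n)])
  simpa using this

lemma integral_Ioi_pow_mul_exp_neg_sq_add_two (n : ℕ) :
    ∫ r in Set.Ioi (0 : ℝ), r ^ (n + 2) * Real.exp (-r ^ 2) =
      ((n : ℝ) + 1) / 2 * ∫ r in Set.Ioi (0 : ℝ), r ^ n * Real.exp (-r ^ 2) := by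
  rw [integral_Ioi_pow_mul_exp_neg_sq, integral_Ioi_pow_mul_exp_neg_sq]
  have : (((n + 2 : ℕ) : ℝ) + 1) / 2 = ((n : ℝ) + 1) / 2 + 1 := by push_cast; ring
  rw [this, Real.Gamma_add_one (by positivity)]
  ring

lemma integral_Ioi_pow_mul_exp_neg_sq_pos (n : ℕ) :
    0 < ∫ r in Set.Ioi (0 : ℝ), r ^ n * Real.exp (-r ^ 2) := by
  rw [integral_Ioi_pow_mul_exp_neg_sq]
  have := Real.Gamma_pos_of_pos (s := ((n : ℝ) + 1) / 2) (by positivity)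
  positivity

lemma integral_even_pow_mul_exp_neg_sq_succ (k : ℕ) :
    ∫ t : ℝ, t ^ (2 * (k + 1)) * Real.exp (-t ^ 2) =
      (2 * (k : ℝ) + 1) / 2 * ∫ t : ℝ, t ^ (2 * k) * Real.exp (-t ^ 2) := by
  have h : ∀ j : ℕ, ∫ t : ℝ, t ^ (2 * j) * Real.exp (-t ^ 2) =
      2 * ∫ t in Set.Ioi (0 : ℝ), t ^ (2 * j) * Real.exp (-t ^ 2) := fun j => by
    rw [← integral_comp_abs]
    simp only [pow_mul, sq_abs]
  rw [h, h, mul_add, mul_one, integral_Ioi_pow_mul_exp_neg_sq_add_two]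
  push_cast
  ring

/-- The recursion for the even moments of one coordinate under the Gaussian weight. -/
lemma integral_coord_pow_mul_exp_succ {d : ℕ} (i : Fin d) (k : ℕ) :
    ∫ y : EuclideanSpace ℝ (Fin d), y i ^ (2 * (k + 1)) * Real.exp (-‖y‖ ^ 2) =
      (2 * (k : ℝ) + 1) / 2 *
        ∫ y : EuclideanSpace ℝ (Fin d), y i ^ (2 * k) * Real.exp (-‖y‖ ^ 2) := by
  have h : ∀ k : ℕ, ∫ y : EuclideanSpace ℝ (Fin d), y i ^ (2 * k) * Real.exp (-‖y‖ ^ 2) =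
      (∫ t : ℝ, t ^ (2 * k) * Real.exp (-t ^ 2)) *
        ∏ _j ∈ Finset.univ.erase i, ∫ t : ℝ, Real.exp (-t ^ 2) := fun k => by
    have h1 : ∀ y : EuclideanSpace ℝ (Fin d), y i ^ (2 * k) * Real.exp (-‖y‖ ^ 2) =
        ∏ j, (if j = i then y j ^ (2 * k) else 1) * Real.exp (-y j ^ 2) := fun y => by
      rw [Finset.prod_mul_distrib, ← Real.exp_sum, Finset.sum_neg_distrib,
        ← EuclideanSpace.real_norm_sq_eq, Finset.prod_ite_eq']
      simp
    calc _ = ∫ y : EuclideanSpace ℝ (Fin d),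
          (fun z : Fin d → ℝ => ∏ j, (if j = i then z j ^ (2 * k) else 1) * Real.exp (-z j ^ 2))
            (WithLp.ofLp y) := integral_congr_ae (Filter.Eventually.of_forall h1)
      _ = ∫ z : Fin d → ℝ, ∏ j, (if j = i then z j ^ (2 * k) else 1) * Real.exp (-z j ^ 2) :=
          (EuclideanSpace.volume_preserving_symm_measurableEquiv_toLp (Fin d)).integral_comp
            (MeasurableEquiv.toLp 2 (Fin d → ℝ)).symm.measurableEmbedding
            (fun z : Fin d → ℝ => ∏ j, (if j = i then z j ^ (2 * k) else 1) * Real.exp (-z j ^ 2))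
      _ = ∏ j, ∫ t : ℝ, (if j = i then t ^ (2 * k) else 1) * Real.exp (-t ^ 2) :=
          integral_fintype_prod_volume_eq_prod
            (fun (j : Fin d) (t : ℝ) => (if j = i then t ^ (2 * k) else 1) * Real.exp (-t ^ 2))
      _ = _ := by
          rw [← Finset.mul_prod_erase _ _ (Finset.mem_univ i)]
          congr 1
          · simp
          · refine Finset.prod_congr rfl fun j hj => ?_
            simp [Finset.ne_of_mem_erase hj]
  rw [h, h, integral_even_pow_mul_exp_neg_sq_succ]
  ring

/-- Rotation invariance: the Gaussian moments of a linear form depend only on its norm. -/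
lemma integral_inner_pow_mul_exp {d : ℕ} (i : Fin d) (x : EuclideanSpace ℝ (Fin d)) (n : ℕ) :
    ∫ y : EuclideanSpace ℝ (Fin d), ⟪x, y⟫ ^ n * Real.exp (-‖y‖ ^ 2) =
      ‖x‖ ^ n * ∫ y : EuclideanSpace ℝ (Fin d), y i ^ n * Real.exp (-‖y‖ ^ 2) := by
  -- the reflection exchanging `x` and `‖x‖ eᵢ`
  set e : EuclideanSpace ℝ (Fin d) := ‖x‖ • EuclideanSpace.single i (1 : ℝ)
  have he : ‖x‖ = ‖e‖ := by simp [e, norm_smul]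
  set T := Submodule.reflection (ℝ ∙ (x - e))ᗮ
  have hT : T x = e := Submodule.reflection_sub he
  have hcomp := (LinearIsometryEquiv.measurePreserving T).integral_comp
    T.toHomeomorph.measurableEmbedding
    (fun y : EuclideanSpace ℝ (Fin d) => ⟪e, y⟫ ^ n * Real.exp (-‖y‖ ^ 2))
  rw [← integral_const_mul]
  calc _ = ∫ y : EuclideanSpace ℝ (Fin d), ⟪e, T y⟫ ^ n * Real.exp (-‖T y‖ ^ 2) := by
        refine integral_congr_ae (Filter.Eventually.of_forall fun y => ?_)
        simp only [← hT, LinearIsometryEquiv.inner_map_map, LinearIsometryEquiv.norm_map]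
    _ = ∫ y : EuclideanSpace ℝ (Fin d), ⟪e, y⟫ ^ n * Real.exp (-‖y‖ ^ 2) := hcomp
    _ = _ := by
        refine integral_congr_ae (Filter.Eventually.of_forall fun y => ?_)
        simp only [e, real_inner_smul_left, EuclideanSpace.inner_single_left, map_one, one_mul]
        ring

lemma sphere_moment_mul {d : ℕ} (hd : 1 ≤ d) (x : EuclideanSpace ℝ (Fin d)) (n : ℕ) :
    ∫ y : EuclideanSpace ℝ (Fin d), ⟪x, y⟫ ^ n * Real.exp (-‖y‖ ^ 2) =
      (∫ ω : UnitSphere d, ⟪x, (ω : EuclideanSpace ℝ (Fin d))⟫ ^ n ∂surfaceMeasure d) *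
        ∫ r in Set.Ioi (0 : ℝ), r ^ (n + (d - 1)) * Real.exp (-r ^ 2) :=
  integral_polar hd n (fun y => ⟪x, y⟫ ^ n) (fun r => Real.exp (-r ^ 2)) fun r _ y => by
    rw [real_inner_smul_right, mul_pow]

/-- The odd moments of the sphere vanish. -/
lemma sphere_moment_odd {d : ℕ} (hd : 1 ≤ d) (x : EuclideanSpace ℝ (Fin d)) {n : ℕ} (hn : Odd n) :
    ∫ ω : UnitSphere d, ⟪x, (ω : EuclideanSpace ℝ (Fin d))⟫ ^ n ∂surfaceMeasure d = 0 := by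
  have h := sphere_moment_mul hd x n
  have h0 : ∫ y : EuclideanSpace ℝ (Fin d), ⟪x, y⟫ ^ n * Real.exp (-‖y‖ ^ 2) = 0 := by
    have := integral_neg_eq_self
      (fun y : EuclideanSpace ℝ (Fin d) => ⟪x, y⟫ ^ n * Real.exp (-‖y‖ ^ 2)) volume
    simp only [inner_neg_right, norm_neg, hn.neg_pow, neg_mul, integral_neg] at this
    linarith
  rw [h0] at h
  exact (mul_eq_zero.1 h.symm).resolve_right (integral_Ioi_pow_mul_exp_neg_sq_pos _).ne'

/-- The even moments of the sphere, found by comparing the Gaussian integral of `⟪x, y⟫^{2k}` in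
Cartesian and in polar coordinates. -/
lemma sphere_moment_even {d : ℕ} (hd : 1 ≤ d) (x : EuclideanSpace ℝ (Fin d)) (k : ℕ) :
    ∫ ω : UnitSphere d, ⟪x, (ω : EuclideanSpace ℝ (Fin d))⟫ ^ (2 * k) ∂surfaceMeasure d =
      sphereArea d * (((2 * k).factorial : ℝ) * besselCoeff d k * ‖x‖ ^ (2 * k)) := by
  induction k with
  | zero => simp [besselCoeff, sphereArea]
  | succ k ih =>
    have h0 := sphere_moment_mul hd x (2 * k)
    have h1 := sphere_moment_mul hd x (2 * (k + 1))
    rw [integral_inner_pow_mul_exp ⟨0, hd⟩] at h0 h1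
    rw [integral_coord_pow_mul_exp_succ,
      show 2 * (k + 1) + (d - 1) = 2 * k + (d - 1) + 2 by ring,
      integral_Ioi_pow_mul_exp_neg_sq_add_two] at h1
    rw [ih] at h0
    set K := ∫ r in Set.Ioi (0 : ℝ), r ^ (2 * k + (d - 1)) * Real.exp (-r ^ 2)
    have hK : 0 < K := integral_Ioi_pow_mul_exp_neg_sq_pos _
    set M := ∫ y : EuclideanSpace ℝ (Fin d), y ⟨0, hd⟩ ^ (2 * k) * Real.exp (-‖y‖ ^ 2)
    set m := ∫ ω : UnitSphere d, ⟪x, (ω : EuclideanSpace ℝ (Fin d))⟫ ^ (2 * (k + 1))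
      ∂surfaceMeasure d
    have hd' : (1 : ℝ) ≤ d := by exact_mod_cast hd
    have hc : besselCoeff d (k + 1) = besselCoeff d k *
        (1 / ((2 * (k : ℝ) + 2) * ((d : ℝ) + 2 * k))) := by
      rw [besselCoeff, Finset.prod_range_succ, ← besselCoeff]
    have hf : ((2 * (k + 1)).factorial : ℝ) = (2 * k + 2) * ((2 * k + 1) * (2 * k).factorial) := by
      rw [show 2 * (k + 1) = 2 * k + 1 + 1 by ring, Nat.factorial_succ, Nat.factorial_succ]
      push_cast
      ring
    have hcast : ((2 * k + (d - 1) : ℕ) : ℝ) + 1 = d + 2 * k := by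
      rw [← Nat.cast_succ, show (2 * k + (d - 1)).succ = d + 2 * k by omega]
      push_cast
      ring
    rw [hcast] at h1
    rw [hc, hf]
    have hne : ((d : ℝ) + 2 * k) / 2 * K ≠ 0 := by positivity
    apply mul_right_cancel₀ hne
    have hpow : ‖x‖ ^ (2 * (k + 1)) = ‖x‖ ^ 2 * ‖x‖ ^ (2 * k) := by ring
    rw [hpow] at h1 ⊢
    have : ((d : ℝ) + 2 * k) ≠ 0 := by positivity
    have h2 : m * (((d : ℝ) + 2 * k) / 2 * K) =
        ‖x‖ ^ 2 * ((2 * k + 1) / 2) * (‖x‖ ^ (2 * k) * M) := by linear_combination -h1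
    rw [h2, h0]
    field_simp

/-- The Fourier transform of the surface measure: the exponential series is integrated term by term
against the moments of the sphere. -/
lemma extension_one {d : ℕ} (hd : 1 ≤ d) (x : EuclideanSpace ℝ (Fin d)) :
    extension d (one d) x = ((sphereArea d * normBessel d (‖x‖ ^ 2) : ℝ) : ℂ) := by
  have h1 : extension d (one d) x = ∫ ω : UnitSphere d, ∑' n : ℕ,
      ((-Complex.I) ^ n / (n.factorial : ℂ)) *
        ((⟪x, (ω : EuclideanSpace ℝ (Fin d))⟫ ^ n : ℝ) : ℂ) ∂surfaceMeasure d := by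
    refine integral_congr_ae ?_
    filter_upwards [Lp.coeFn_const 2 (surfaceMeasure d) (1 : ℂ)] with ω hω
    rw [one, hω, Function.const_apply, one_mul, Complex.exp_eq_exp_ℂ, NormedSpace.exp_eq_tsum_div]
    refine tsum_congr fun n => ?_
    rw [← neg_mul, mul_pow]
    push_cast
    ring
  have hbound : ∀ (n : ℕ) (ω : UnitSphere d), ‖((-Complex.I) ^ n / (n.factorial : ℂ)) *
      ((⟪x, (ω : EuclideanSpace ℝ (Fin d))⟫ ^ n : ℝ) : ℂ)‖ ≤ ‖x‖ ^ n / n.factorial := fun n ω => by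
    have hω : ‖(ω : EuclideanSpace ℝ (Fin d))‖ = 1 := by simp
    have hin : |⟪x, (ω : EuclideanSpace ℝ (Fin d))⟫| ≤ ‖x‖ := by
      simpa [hω] using abs_real_inner_le_norm x (ω : EuclideanSpace ℝ (Fin d))
    rw [norm_mul, norm_div, norm_pow, norm_neg, Complex.norm_I, one_pow, Complex.norm_real,
      norm_pow, Real.norm_eq_abs, Complex.norm_natCast, one_div, inv_mul_eq_div]
    gcongr
  have hcont : ∀ n : ℕ, Continuous fun ω : UnitSphere d => ((-Complex.I) ^ n / (n.factorial : ℂ)) *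
      ((⟪x, (ω : EuclideanSpace ℝ (Fin d))⟫ ^ n : ℝ) : ℂ) := fun n => by fun_prop
  have hint : ∀ n : ℕ, Integrable (fun ω : UnitSphere d => ((-Complex.I) ^ n / (n.factorial : ℂ)) *
      ((⟪x, (ω : EuclideanSpace ℝ (Fin d))⟫ ^ n : ℝ) : ℂ)) (surfaceMeasure d) := fun n =>
    Integrable.of_bound (hcont n).aestronglyMeasurable _ (Filter.Eventually.of_forall (hbound n))
  have hsum := hasSum_integral_of_summable_integral_norm hint (by
    refine Summable.of_nonneg_of_le (fun n => integral_nonneg fun ω => norm_nonneg _) (fun n => ?_)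
      ((Real.summable_pow_div_factorial ‖x‖).mul_right (sphereArea d))
    refine (integral_mono (hint n).norm (integrable_const _) (hbound n)).trans ?_
    rw [integral_const, smul_eq_mul, mul_comm, sphereArea])
  rw [← h1] at hsum
  have hterm : ∀ n : ℕ, ∫ ω : UnitSphere d, ((-Complex.I) ^ n / (n.factorial : ℂ)) *
      ((⟪x, (ω : EuclideanSpace ℝ (Fin d))⟫ ^ n : ℝ) : ℂ) ∂surfaceMeasure d =
      ((-Complex.I) ^ n / (n.factorial : ℂ)) * ((∫ ω : UnitSphere d,
        ⟪x, (ω : EuclideanSpace ℝ (Fin d))⟫ ^ n ∂surfaceMeasure d : ℝ) : ℂ) := fun n => by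
    rw [integral_const_mul, integral_complex_ofReal]
  simp only [hterm] at hsum
  have hinj : Function.Injective fun k : ℕ => 2 * k := fun a b h => by simpa using h
  -- only the even terms survive
  rw [← hinj.hasSum_iff] at hsum
  · have hb := (Complex.hasSum_ofReal.2
      ((summable_normBessel hd (‖x‖ ^ 2)).hasSum.mul_left (sphereArea d)))
    refine hsum.unique (hb.congr_fun ?_)
    intro k
    simp only [Function.comp_apply]
    rw [sphere_moment_even hd, pow_mul, neg_sq, Complex.I_sq]
    have : ((2 * k).factorial : ℂ) ≠ 0 := by exact_mod_cast (Nat.factorial_ne_zero _)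
    push_cast
    field_simp
    ring
  · intro n hn
    have : Odd n := by
      rcases Nat.even_or_odd n with h | h
      · exact absurd ⟨n / 2, by simpa using Nat.two_mul_div_two_of_even h⟩ hn
      · exact h
    rw [sphere_moment_odd hd x this]
    simp

/-! ### Decay, integrability and integration by parts -/

/-- In dimension `d ≥ 3` the quantity `r²u² + (r u)'² + (d-3)u²` is nonincreasing along
`u(r) = normBessel d (r²)`; this yields decay of order `1/r` with an explicit constant. -/
lemma sq_mul_radial_sq_le {d : ℕ} (hd : 3 ≤ d) {T r : ℝ} (hT : 0 ≤ T) (hr : T ≤ r) :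
    r ^ 2 * normBessel d (r ^ 2) ^ 2 ≤
      T ^ 2 * normBessel d (T ^ 2) ^ 2 +
        (normBessel d (T ^ 2) - T ^ 2 / d * normBessel (d + 2) (T ^ 2)) ^ 2 +
        (d - 3) * normBessel d (T ^ 2) ^ 2 := by
  have hd1 : 1 ≤ d := by omega
  have hd' : (3 : ℝ) ≤ d := by exact_mod_cast hd
  have hcu := continuous_radial hd1
  have hcv := continuous_radial (d := d + 2) (by omega)
  have := antitoneOn_Ici_of_hasDerivAt (a := 0)
    (f := fun r => r ^ 2 * normBessel d (r ^ 2) ^ 2 +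
        (normBessel d (r ^ 2) - r ^ 2 / d * normBessel (d + 2) (r ^ 2)) ^ 2 +
        (d - 3) * normBessel d (r ^ 2) ^ 2)
    (f' := fun r => -(2 * (d - 3) * r * (r / d * normBessel (d + 2) (r ^ 2)) ^ 2))
    (by fun_prop)
    (fun r hr => by
      have h1 := hasDerivAt_radial hd1 r
      have h2 := hasDerivAt_radial_shift hd1 hr.ne'
      refine ((((hasDerivAt_pow 2 r).mul (h1.pow 2)).add
        ((h1.sub (((hasDerivAt_pow 2 r).div_const (d : ℝ)).mul h2)).pow 2)).add
        ((h1.pow 2).const_mul ((d : ℝ) - 3))).congr_deriv ?_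
      have := hr.ne'
      simp
      field_simp
      ring)
    (fun r hr => by
      have : 0 ≤ (d : ℝ) - 3 := by linarith
      have : 0 ≤ 2 * ((d : ℝ) - 3) * r * (r / d * normBessel (d + 2) (r ^ 2)) ^ 2 := by positivity
      linarith)
  have h := this (Set.mem_Ici.2 hT) (Set.mem_Ici.2 (hT.trans hr)) hr
  simp only at h
  have : 0 ≤ ((d : ℝ) - 3) * normBessel d (r ^ 2) ^ 2 :=
    mul_nonneg (by linarith) (sq_nonneg _)
  nlinarith [sq_nonneg (normBessel d (r ^ 2) - r ^ 2 / d * normBessel (d + 2) (r ^ 2))]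

/-- In dimension `2`, Sonin's function of `w = √r u`, namely `w'² + (1 + 1/(4r²)) w²`, is
nonincreasing; this yields decay of order `r^{-1/2}` with an explicit constant. -/
lemma mul_radial_two_sq_le {T r : ℝ} (hT : 0 < T) (hr : T ≤ r) :
    r * normBessel 2 (r ^ 2) ^ 2 ≤
      T * (normBessel 2 (T ^ 2) ^ 2 + (T / 2 * normBessel 4 (T ^ 2)) ^ 2) -
        T / 2 * normBessel 2 (T ^ 2) * normBessel 4 (T ^ 2) +
        normBessel 2 (T ^ 2) ^ 2 / (2 * T) := by
  have hder : ∀ r : ℝ, 0 < r → HasDerivAt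
      (fun r => r * (normBessel 2 (r ^ 2) ^ 2 + (r / 2 * normBessel 4 (r ^ 2)) ^ 2) -
        r / 2 * normBessel 2 (r ^ 2) * normBessel 4 (r ^ 2) + normBessel 2 (r ^ 2) ^ 2 / (2 * r))
      (-(normBessel 2 (r ^ 2) ^ 2 / (2 * r ^ 2))) r := fun r hr => by
    have h1 : HasDerivAt (fun r : ℝ => normBessel 2 (r ^ 2))
        (-(r / 2) * normBessel 4 (r ^ 2)) r := by
      simpa using hasDerivAt_radial (d := 2) (by norm_num) r
    have h2 : HasDerivAt (fun r : ℝ => normBessel 4 (r ^ 2))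
        (2 / r * (normBessel 2 (r ^ 2) - normBessel 4 (r ^ 2))) r := by
      simpa using hasDerivAt_radial_shift (d := 2) (by norm_num) hr.ne'
    have hid := hasDerivAt_id r
    refine (((hid.mul ((h1.pow 2).add (((hid.div_const 2).mul h2).pow 2))).sub
      (((hid.div_const 2).mul h1).mul h2)).add
      ((h1.pow 2).div (hid.const_mul 2) (by simpa using hr.ne'))).congr_deriv ?_
    have := hr.ne'
    simp
    field_simp
    ring
  have := antitoneOn_Ici_of_hasDerivAt (a := T)
    (continuousOn_of_forall_continuousAt fun r hr =>
      (hder r (hT.trans_le hr)).continuousAt)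
    (fun r hr => hder r (hT.trans hr)) (fun r _ => by
      have : 0 ≤ normBessel 2 (r ^ 2) ^ 2 / (2 * r ^ 2) := by positivity
      linarith)
  have h := this (Set.mem_Ici.2 le_rfl) (Set.mem_Ici.2 hr) hr
  simp only at h
  refine le_trans ?_ h
  have hr0 : 0 < r := hT.trans_le hr
  -- completing the square in `u'`
  have : r * (normBessel 2 (r ^ 2) ^ 2 + (r / 2 * normBessel 4 (r ^ 2)) ^ 2) -
        r / 2 * normBessel 2 (r ^ 2) * normBessel 4 (r ^ 2) + normBessel 2 (r ^ 2) ^ 2 / (2 * r) =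
      r * normBessel 2 (r ^ 2) ^ 2 +
        (r * (r / 2 * normBessel 4 (r ^ 2) - normBessel 2 (r ^ 2) / (2 * r)) ^ 2 +
          normBessel 2 (r ^ 2) ^ 2 / (4 * r)) := by
    field_simp
    ring
  rw [this]
  have : 0 ≤ r * (r / 2 * normBessel 4 (r ^ 2) - normBessel 2 (r ^ 2) / (2 * r)) ^ 2 +
          normBessel 2 (r ^ 2) ^ 2 / (4 * r) := by positivity
  linarith

/-- Decay of `u(r) = normBessel d (r²)` for which `|u|^p r^{d-1}` is integrable on `(0, ∞)`, with a
power of `r` to spare: `|u|^p r^{d-1} = O(r⁻²)`. -/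
def RadialDecay (d p : ℕ) : Prop :=
  ∃ K : ℝ, ∀ r : ℝ, 1 ≤ r → |normBessel d (r ^ 2)| ^ p * r ^ (d + 1) ≤ K

lemma radialDecay_of_three_le {d : ℕ} (hd : 3 ≤ d) (hd7 : d ≤ 7) : RadialDecay d 8 := by
  refine ⟨((d : ℝ) - 2) ^ 4, fun r hr => ?_⟩
  have hd' : (3 : ℝ) ≤ d := by exact_mod_cast hd
  have h := sq_mul_radial_sq_le hd le_rfl (zero_le_one.trans hr)
  norm_num at h
  have h' : r ^ 2 * normBessel d (r ^ 2) ^ 2 ≤ (d : ℝ) - 2 := by linarith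
  calc |normBessel d (r ^ 2)| ^ 8 * r ^ (d + 1)
      ≤ |normBessel d (r ^ 2)| ^ 8 * r ^ 8 := by
        exact mul_le_mul_of_nonneg_left (pow_le_pow_right₀ hr (by omega)) (by positivity)
    _ = (r ^ 2 * normBessel d (r ^ 2) ^ 2) ^ 4 := by
        rw [← sq_abs (normBessel d (r ^ 2))]; ring
    _ ≤ _ := by gcongr

lemma radialDecay_two : RadialDecay 2 12 := by
  obtain ⟨C, hC⟩ : ∃ C : ℝ, ∀ r : ℝ, 1 ≤ r → r * normBessel 2 (r ^ 2) ^ 2 ≤ C :=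
    ⟨_, fun r hr => mul_radial_two_sq_le one_pos hr⟩
  refine ⟨C ^ 6, fun r hr => ?_⟩
  have hr0 : 0 < r := by linarith
  have h := hC r hr
  calc |normBessel 2 (r ^ 2)| ^ 12 * r ^ (2 + 1)
      ≤ |normBessel 2 (r ^ 2)| ^ 12 * r ^ 6 :=
        mul_le_mul_of_nonneg_left (pow_le_pow_right₀ hr (by norm_num)) (by positivity)
    _ = (r * normBessel 2 (r ^ 2) ^ 2) ^ 6 := by
        rw [← sq_abs (normBessel 2 (r ^ 2))]; ring
    _ ≤ _ := by gcongr

section Decay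

variable {d p : ℕ} {q : ℝ}

lemma abs_radial_rpow_le (hd : 1 ≤ d) (hq : (p : ℝ) ≤ q) {r : ℝ} (hr : 0 ≤ r) (hp : 1 ≤ p) :
    |normBessel d (r ^ 2)| ^ q ≤ |normBessel d (r ^ 2)| ^ p := by
  rw [← Real.rpow_natCast _ p]
  have : (1 : ℝ) ≤ p := by exact_mod_cast hp
  exact Real.rpow_le_rpow_of_exponent_ge_of_imp (abs_nonneg _) (abs_radial_le_one hd hr) hq
    (fun _ h => by linarith)

lemma continuous_radial_rpow (hd : 1 ≤ d) (hq : 0 ≤ q) :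
    Continuous fun r : ℝ => |normBessel d (r ^ 2)| ^ q :=
  (continuous_radial hd).abs.rpow_const fun _ => Or.inr hq

lemma integrableOn_of_radialDecay (hd : 1 ≤ d) (hp : 1 ≤ p) (hdec : RadialDecay d p)
    (hq : (p : ℝ) ≤ q) {h : ℝ → ℝ} (hc : Continuous h)
    (hh : ∀ r, 0 ≤ r → |h r| ≤ |normBessel d (r ^ 2)| ^ q * r ^ (d - 1)) :
    IntegrableOn h (Set.Ioi 0) := by
  obtain ⟨K, hK⟩ := hdec
  rw [← Set.Ioc_union_Ioi_eq_Ioi zero_le_one]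
  refine IntegrableOn.union ?_ ?_
  · exact (hc.integrableOn_Icc (a := 0) (b := 1)).mono_set Set.Ioc_subset_Icc_self
  · have hi : IntegrableOn (fun r : ℝ => K * r ^ (-2 : ℝ)) (Set.Ioi 1) :=
      (integrableOn_Ioi_rpow_of_lt (by norm_num) zero_lt_one).const_mul K
    refine Integrable.mono' hi hc.aestronglyMeasurable ?_
    refine (ae_restrict_iff' measurableSet_Ioi).2 (Filter.Eventually.of_forall fun r hr => ?_)
    have hr1 : (1 : ℝ) < r := hr
    have hr0 : 0 < r := by linarith
    rw [Real.norm_eq_abs]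
    refine (hh r hr0.le).trans ?_
    have h2 : r ^ (-2 : ℝ) = (r ^ 2)⁻¹ := by
      rw [Real.rpow_neg hr0.le]; norm_num
    rw [h2, ← div_eq_mul_inv, le_div_iff₀ (by positivity)]
    calc |normBessel d (r ^ 2)| ^ q * r ^ (d - 1) * r ^ 2
        = |normBessel d (r ^ 2)| ^ q * r ^ (d + 1) := by
          rw [mul_assoc, ← pow_add, show d - 1 + 2 = d + 1 by omega]
      _ ≤ |normBessel d (r ^ 2)| ^ p * r ^ (d + 1) := by
          gcongr
          exact abs_radial_rpow_le hd hq hr0.le hp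
      _ ≤ K := hK r hr1.le

lemma integrableOn_radial_rpow (hd : 1 ≤ d) (hp : 1 ≤ p) (hdec : RadialDecay d p)
    (hq : (p : ℝ) ≤ q) :
    IntegrableOn (fun r : ℝ => |normBessel d (r ^ 2)| ^ q * r ^ (d - 1)) (Set.Ioi 0) := by
  have hq0 : 0 ≤ q := (Nat.cast_nonneg p).trans hq
  refine integrableOn_of_radialDecay hd hp hdec hq
    ((continuous_radial_rpow hd hq0).mul (continuous_pow _)) fun r hr => ?_
  rw [abs_of_nonneg (by positivity)]

lemma continuous_radial_rpow_mul_deriv_sq (hd : 1 ≤ d) (hq : 0 ≤ q) :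
    Continuous fun r : ℝ => |normBessel d (r ^ 2)| ^ q *
      (r / d * normBessel (d + 2) (r ^ 2)) ^ 2 * r ^ (d - 1) := by
  have := continuous_radial_rpow hd hq
  have := continuous_radial (d := d + 2) (by omega)
  fun_prop

lemma integrableOn_radial_rpow_mul_deriv_sq (hd : 1 ≤ d) (hp : 1 ≤ p) (hdec : RadialDecay d p)
    (hq : (p : ℝ) ≤ q) :
    IntegrableOn (fun r : ℝ => |normBessel d (r ^ 2)| ^ q *
      (r / d * normBessel (d + 2) (r ^ 2)) ^ 2 * r ^ (d - 1)) (Set.Ioi 0) := by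
  have hq0 : 0 ≤ q := (Nat.cast_nonneg p).trans hq
  refine integrableOn_of_radialDecay hd hp hdec hq (continuous_radial_rpow_mul_deriv_sq hd hq0)
    fun r hr => ?_
  rw [abs_of_nonneg (by positivity)]
  gcongr
  refine mul_le_of_le_one_right (by positivity) ?_
  nlinarith [energy_le_one hd hr, sq_nonneg (normBessel d (r ^ 2))]

/-- The derivative of `|x|^q x`. -/
lemma hasDerivAt_abs_rpow_mul_self (hq : 1 < q) (x : ℝ) :
    HasDerivAt (fun x : ℝ => |x| ^ q * x) ((q + 1) * |x| ^ q) x := by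
  refine ((hasDerivAt_abs_rpow x hq).mul (hasDerivAt_id x)).congr_deriv ?_
  have : |x| ^ (q - 2) * x * x = |x| ^ q := by
    rcases eq_or_ne x 0 with rfl | hx
    · rw [abs_zero, Real.zero_rpow (by linarith : q ≠ 0)]; simp
    · have h0 : 0 < |x| := abs_pos.2 hx
      rw [mul_assoc, ← sq, ← sq_abs, ← Real.rpow_natCast |x| 2, ← Real.rpow_add h0]
      norm_num
  simp only [id, mul_one]
  linear_combination q * this

lemma abs_rpow_add_two (hq : 0 < q) (x : ℝ) : |x| ^ (q + 2) = |x| ^ q * x ^ 2 := by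
  rcases eq_or_ne x 0 with rfl | hx
  · rw [abs_zero, Real.zero_rpow (by linarith : q + 2 ≠ 0)]; simp
  · rw [Real.rpow_add (abs_pos.2 hx), ← sq_abs]
    norm_num

/-- Integration by parts with `-Δu = u`: `∫ |u|^{q+2} = (q+1) ∫ |u|^q |∇u|²`. -/
lemma integral_radial_rpow_add_two (hd : 1 ≤ d) (hp : 2 ≤ p) (hdec : RadialDecay d p)
    (hq : (p : ℝ) ≤ q) :
    ∫ r in Set.Ioi (0 : ℝ), |normBessel d (r ^ 2)| ^ (q + 2) * r ^ (d - 1) =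
      (q + 1) * ∫ r in Set.Ioi (0 : ℝ), |normBessel d (r ^ 2)| ^ q *
        (r / d * normBessel (d + 2) (r ^ 2)) ^ 2 * r ^ (d - 1) := by
  have hp' : (2 : ℝ) ≤ p := by exact_mod_cast hp
  have hd' : (1 : ℝ) ≤ d := by exact_mod_cast hd
  have hq1 : 1 < q := by linarith
  have hi1 := integrableOn_radial_rpow hd (by omega) hdec (q := q + 2) (by linarith)
  have hi2 := (integrableOn_radial_rpow_mul_deriv_sq hd (by omega) hdec hq).const_mul (q + 1)
  obtain ⟨e, rfl⟩ : ∃ e, d = e + 1 := ⟨d - 1, by omega⟩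
  have hcu := continuous_radial hd
  have hcv := continuous_radial (d := e + 1 + 2) (by omega)
  have hcF := continuous_radial_rpow hd (q := q) (by linarith)
  have key := integral_Ioi_of_hasDerivAt_of_tendsto (a := 0) (m := 0)
    (f := fun r : ℝ => -(1 / ((e + 1 : ℕ) : ℝ)) *
      ((|normBessel (e + 1) (r ^ 2)| ^ q * normBessel (e + 1) (r ^ 2)) *
        (normBessel (e + 1 + 2) (r ^ 2) * r ^ (e + 1))))
    (f' := fun r : ℝ => (q + 1) * (|normBessel (e + 1) (r ^ 2)| ^ q *
        (r / ((e + 1 : ℕ) : ℝ) * normBessel (e + 1 + 2) (r ^ 2)) ^ 2 * r ^ (e + 1 - 1)) -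
        |normBessel (e + 1) (r ^ 2)| ^ (q + 2) * r ^ (e + 1 - 1))
    (by
      refine Continuous.continuousWithinAt ?_
      fun_prop)
    (fun r hr => by
      have hr0 : (0 : ℝ) < r := hr
      have h1 := (hasDerivAt_abs_rpow_mul_self hq1 (normBessel (e + 1) (r ^ 2))).comp r
        (hasDerivAt_radial hd r)
      have h2 := (hasDerivAt_radial_shift hd hr0.ne').mul (hasDerivAt_pow (e + 1) r)
      refine ((h1.mul h2).const_mul _).congr_deriv ?_
      have := hr0.ne'
      rw [abs_rpow_add_two (by linarith)]
      simp only [Function.comp_apply, Pi.mul_apply, Nat.add_sub_cancel]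
      push_cast at hd' ⊢
      have : (e : ℝ) + 1 ≠ 0 := by positivity
      field_simp
      ring)
    (by exact hi2.sub hi1)
    (by
      obtain ⟨K, hK⟩ := hdec
      refine squeeze_zero_norm' (a := fun r : ℝ => |K| * (r ^ 2)⁻¹) ?_ ?_
      · filter_upwards [Filter.eventually_ge_atTop (1 : ℝ)] with r hr
        have hr0 : 0 < r := by linarith
        have hE := energy_le_one hd hr0.le
        have hu := abs_radial_le_one hd hr0.le
        have hv : |r / ((e + 1 : ℕ) : ℝ) * normBessel (e + 1 + 2) (r ^ 2)| ≤ 1 :=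
          abs_le_one_iff_mul_self_le_one.2
            (by nlinarith [sq_nonneg (normBessel (e + 1) (r ^ 2))])
        have h3 := hK r hr
        have h4 := abs_radial_rpow_le hd hq hr0.le (by omega)
        rw [← div_eq_mul_inv, le_div_iff₀ (by positivity), Real.norm_eq_abs]
        have h5 : -(1 / ((e + 1 : ℕ) : ℝ)) *
            ((|normBessel (e + 1) (r ^ 2)| ^ q * normBessel (e + 1) (r ^ 2)) *
              (normBessel (e + 1 + 2) (r ^ 2) * r ^ (e + 1))) =
            -(|normBessel (e + 1) (r ^ 2)| ^ q * normBessel (e + 1) (r ^ 2) *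
              (r / ((e + 1 : ℕ) : ℝ) * normBessel (e + 1 + 2) (r ^ 2)) * r ^ e) := by
          field_simp
          ring
        rw [h5, abs_neg, abs_mul, abs_mul, abs_mul, abs_of_nonneg (by positivity :
          0 ≤ |normBessel (e + 1) (r ^ 2)| ^ q), abs_of_pos (by positivity : 0 < r ^ e)]
        calc _ ≤ |normBessel (e + 1) (r ^ 2)| ^ p * 1 * 1 * r ^ e * r ^ 2 := by gcongr
          _ = |normBessel (e + 1) (r ^ 2)| ^ p * r ^ (e + 1 + 1) := by ring
          _ ≤ |K| := h3.trans (le_abs_self K)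
      · have : Filter.Tendsto (fun r : ℝ => (r ^ 2)⁻¹) Filter.atTop (nhds 0) :=
          (Filter.tendsto_pow_atTop two_ne_zero).inv_tendsto_atTop
        simpa using this.const_mul |K|)
  rw [integral_sub hi2 hi1, integral_const_mul] at key
  simp at key
  push_cast
  linarith

end Decay

/-! ### Reduction to a radial integral -/

lemma sphereArea_eq (d : ℕ) : sphereArea d =
    d * (volume : Measure (EuclideanSpace ℝ (Fin d))).real (Metric.ball 0 1) := by
  rw [sphereArea, surfaceMeasure, Measure.toSphere_real_apply_univ]
  simp

lemma sphereArea_pos {d : ℕ} (hd : 1 ≤ d) : 0 < sphereArea d := by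
  rw [sphereArea_eq]
  have h1 : (0 : ℝ) < d := by exact_mod_cast hd
  have h2 : 0 < (volume : Measure (EuclideanSpace ℝ (Fin d))).real (Metric.ball 0 1) :=
    ENNReal.toReal_pos (Metric.measure_ball_pos _ _ one_pos).ne' measure_ball_lt_top.ne
  positivity

lemma norm_one_sq {d : ℕ} (hd : 1 ≤ d) : ‖one d‖ ^ 2 = sphereArea d := by
  have : NeZero (surfaceMeasure d) := ⟨fun h => by
    have := sphereArea_pos hd
    rw [sphereArea, h] at this
    simp at this⟩
  rw [one, Lp.norm_const _ _ _ (by norm_num), norm_one, one_mul, ← Real.rpow_natCast,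
    ← Real.rpow_mul measureReal_nonneg, sphereArea]
  norm_num

lemma norm_extension_one {d : ℕ} (hd : 1 ≤ d) (x : EuclideanSpace ℝ (Fin d)) :
    ‖extension d (one d) x‖ = sphereArea d * |normBessel d (‖x‖ ^ 2)| := by
  rw [extension_one hd, Complex.norm_real, Real.norm_eq_abs, abs_mul,
    abs_of_pos (sphereArea_pos hd)]

section Reduction

variable {d p : ℕ} {q : ℝ}

lemma norm_extension_one_rpow (hd : 1 ≤ d) (x : EuclideanSpace ℝ (Fin d)) :
    ‖extension d (one d) x‖ ^ q =
      (fun r : ℝ => sphereArea d ^ q * |normBessel d (r ^ 2)| ^ q) ‖x‖ := by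
  rw [norm_extension_one hd, Real.mul_rpow (sphereArea_pos hd).le (abs_nonneg _)]

lemma memLp_extension_one (hd : 1 ≤ d) (hp : 1 ≤ p) (hdec : RadialDecay d p) (hq : (p : ℝ) ≤ q) :
    MemLp (extension d (one d)) (ENNReal.ofReal q) volume := by
  have : Nonempty (Fin d) := ⟨⟨0, hd⟩⟩
  have hp' : (1 : ℝ) ≤ p := by exact_mod_cast hp
  have hq0 : 0 < q := by linarith
  have hcont : Continuous (extension d (one d)) := by
    rw [funext (extension_one hd)]
    exact Complex.continuous_ofReal.comp
      (((continuous_radial hd).comp continuous_norm).const_mul _)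
  rw [← integrable_norm_rpow_iff hcont.aestronglyMeasurable (by simpa using hq0)
    ENNReal.ofReal_ne_top, ENNReal.toReal_ofReal hq0.le]
  simp only [norm_extension_one_rpow hd]
  rw [integrable_fun_norm_addHaar volume
    (f := fun r : ℝ => sphereArea d ^ q * |normBessel d (r ^ 2)| ^ q)]
  refine ((integrableOn_radial_rpow hd hp hdec hq).const_mul (sphereArea d ^ q)).congr
    (Filter.Eventually.of_forall fun r => ?_)
  simp only [finrank_euclideanSpace, Fintype.card_fin, smul_eq_mul]
  ring

lemma Phi_one_eq (hd : 1 ≤ d) (hp : 1 ≤ p) (hdec : RadialDecay d p) (hq : (p : ℝ) ≤ q) :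
    Phi d q (one d) = ‖one d‖ ^ q * sphereArea d *
      ∫ r in Set.Ioi (0 : ℝ), |normBessel d (r ^ 2)| ^ q * r ^ (d - 1) := by
  have : Nonempty (Fin d) := ⟨⟨0, hd⟩⟩
  have hp' : (1 : ℝ) ≤ p := by exact_mod_cast hp
  have hq0 : 0 < q := by linarith
  have hn : 0 < ‖one d‖ := by
    have := norm_one_sq hd ▸ sphereArea_pos hd
    exact lt_of_le_of_ne (norm_nonneg _) fun h => by rw [← h] at this; simp at this
  have hI : ∫ x : EuclideanSpace ℝ (Fin d), ‖extension d (one d) x‖ ^ q =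
      ‖one d‖ ^ q * ‖one d‖ ^ q * (sphereArea d *
      ∫ r in Set.Ioi (0 : ℝ), |normBessel d (r ^ 2)| ^ q * r ^ (d - 1)) := by
    simp only [norm_extension_one_rpow hd]
    rw [integral_fun_norm_addHaar (volume : Measure (EuclideanSpace ℝ (Fin d)))
      fun r : ℝ => sphereArea d ^ q * |normBessel d (r ^ 2)| ^ q, finrank_euclideanSpace,
      Fintype.card_fin, nsmul_eq_mul, smul_eq_mul, ← mul_assoc, ← sphereArea_eq,
      ← Real.mul_rpow hn.le hn.le, ← sq, norm_one_sq hd]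
    have : ∫ r in Set.Ioi (0 : ℝ), r ^ (d - 1) • (sphereArea d ^ q * |normBessel d (r ^ 2)| ^ q) =
        sphereArea d ^ q *
          ∫ r in Set.Ioi (0 : ℝ), |normBessel d (r ^ 2)| ^ q * r ^ (d - 1) := by
      rw [← integral_const_mul]
      refine integral_congr_ae (Filter.Eventually.of_forall fun r => ?_)
      simp only [smul_eq_mul]
      ring
    rw [this]
    ring
  rw [Phi, (memLp_extension_one hd hp hdec hq).eLpNorm_eq_integral_rpow_norm
    (by simpa using hq0) ENNReal.ofReal_ne_top, ENNReal.toReal_ofReal hq0.le,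
    ENNReal.toReal_ofReal (by positivity), ← Real.rpow_mul (by positivity),
    inv_mul_cancel₀ hq0.ne', Real.rpow_one, hI]
  have : 0 < ‖one d‖ ^ q := by positivity
  field_simp

/-- The comparison of `Φ` at `q` and `q + 2` amounts to the positivity of a radial integral. -/
lemma Phi_one_lt_of_integral_pos {A : ℝ} (hd : 1 ≤ d) (hp : 2 ≤ p) (hdec : RadialDecay d p)
    (hq : (p : ℝ) ≤ q) (hA : 0 < A)
    (hpos : 0 < ∫ r in Set.Ioi (0 : ℝ), |normBessel d (r ^ 2)| ^ q * r ^ (d - 1) *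
      (A * (r / d * normBessel (d + 2) (r ^ 2)) ^ 2 - 1)) :
    sphereArea d * ((1 + q) / A) * Phi d q (one d) < Phi d (q + 2) (one d) := by
  have hp' : (2 : ℝ) ≤ p := by exact_mod_cast hp
  rw [Phi_one_eq hd (by omega) hdec hq,
    Phi_one_eq hd (by omega) hdec (by linarith : (p : ℝ) ≤ q + 2),
    integral_radial_rpow_add_two hd hp hdec hq]
  have hω := sphereArea_pos hd
  have hn : 0 < ‖one d‖ := by
    have := norm_one_sq hd ▸ hω
    exact lt_of_le_of_ne (norm_nonneg _) fun h => by rw [← h] at this; simp at this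
  rw [Real.rpow_add hn, Real.rpow_two, norm_one_sq hd]
  have hi1 := integrableOn_radial_rpow hd (by omega) hdec hq
  have hi2 := integrableOn_radial_rpow_mul_deriv_sq hd (by omega) hdec hq
  have hsplit : ∫ r in Set.Ioi (0 : ℝ), |normBessel d (r ^ 2)| ^ q * r ^ (d - 1) *
      (A * (r / d * normBessel (d + 2) (r ^ 2)) ^ 2 - 1) =
      A * (∫ r in Set.Ioi (0 : ℝ), |normBessel d (r ^ 2)| ^ q *
        (r / d * normBessel (d + 2) (r ^ 2)) ^ 2 * r ^ (d - 1)) -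
      ∫ r in Set.Ioi (0 : ℝ), |normBessel d (r ^ 2)| ^ q * r ^ (d - 1) := by
    rw [← integral_const_mul, ← integral_sub (hi2.const_mul A) hi1]
    refine integral_congr_ae (Filter.Eventually.of_forall fun r => ?_)
    simp only
    ring
  rw [hsplit] at hpos
  set D := ∫ r in Set.Ioi (0 : ℝ), |normBessel d (r ^ 2)| ^ q *
        (r / d * normBessel (d + 2) (r ^ 2)) ^ 2 * r ^ (d - 1)
  set J := ∫ r in Set.Ioi (0 : ℝ), |normBessel d (r ^ 2)| ^ q * r ^ (d - 1)
  have hc : 0 < sphereArea d * ((1 + q) / A) * (‖one d‖ ^ q * sphereArea d) := by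
    have : 0 < 1 + q := by linarith
    positivity
  have := mul_lt_mul_of_pos_left (sub_pos.1 hpos) hc
  calc _ = sphereArea d * ((1 + q) / A) * (‖one d‖ ^ q * sphereArea d) * J := by ring
    _ < _ := this
    _ = _ := by field_simp; ring

end Reduction

/-! ### Gain and loss in the radial integral -/

/-- The integrand `|u|^q (A u'² - 1) r^{d-1}` whose integral has to be shown positive, where
`u(r) = normBessel d (r²)` and `u'(r) = -(r/d) normBessel (d + 2) (r²)`. -/
noncomputable def radialIntegrand (d : ℕ) (q A r : ℝ) : ℝ :=
  |normBessel d (r ^ 2)| ^ q * r ^ (d - 1) * (A * (r / d * normBessel (d + 2) (r ^ 2)) ^ 2 - 1)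

lemma le_intervalIntegral_of_le_on {f : ℝ → ℝ} {a b x y c : ℝ} (hf : Continuous f)
    (hax : a ≤ x) (hxy : x ≤ y) (hyb : y ≤ b) (h0 : ∀ r ∈ Set.Icc a b, 0 ≤ f r)
    (hc : ∀ r ∈ Set.Icc x y, c ≤ f r) : c * (y - x) ≤ ∫ r in a..b, f r := by
  have h1 : ∫ _r in x..y, c ≤ ∫ r in x..y, f r :=
    intervalIntegral.integral_mono_on hxy intervalIntegrable_const (hf.intervalIntegrable _ _) hc
  rw [intervalIntegral.integral_const, smul_eq_mul, mul_comm] at h1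
  refine h1.trans (intervalIntegral.integral_mono_interval hax hxy hyb ?_
    (hf.intervalIntegrable _ _))
  refine (ae_restrict_iff' measurableSet_Ioc).2 (Filter.Eventually.of_forall fun r hr => ?_)
  exact h0 r ⟨hr.1.le, hr.2⟩

section Positivity

variable {d p : ℕ} {q A : ℝ}

lemma continuous_radialIntegrand (hd : 1 ≤ d) (hq : 0 ≤ q) :
    Continuous (radialIntegrand d q A) := by
  have := continuous_radial_rpow hd hq
  have := continuous_radial (d := d + 2) (by omega)
  unfold radialIntegrand
  fun_prop

/-- The integral of the integrand over `[0, R]` is unchanged when the derivative of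
`d⁻¹ r^d (1 - r²/R²) u^q`, which vanishes at both ends, is added; the new integrand is
`d⁻² r^{d+1} u^{q-1} E` with an explicit `E`, which is nonnegative pointwise. -/
lemma integral_radialIntegrand_core {R κ e r₁ r₂ m : ℝ} (hd : 1 ≤ d) (hp : 2 ≤ p)
    (hq : (p : ℝ) ≤ q) (hR : 0 < R) (hκ : κ * R ^ 2 = d * (d + 2)) (he : 0 ≤ e)
    (hu : ∀ s, 0 ≤ s → s ≤ R ^ 2 → 0 < normBessel d s)
    (hv : ∀ s, 0 ≤ s → s ≤ R ^ 2 → 0 ≤ normBessel (d + 2) s)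
    (huv : ∀ s, 0 ≤ s → s ≤ R ^ 2 → 1 - s / R ^ 2 ≤ normBessel d s * normBessel (d + 2) s)
    (hE : ∀ s, 0 ≤ s → s ≤ R ^ 2 → e ≤ normBessel d s * (A * normBessel (d + 2) s ^ 2 - κ) -
      p * (1 - s / R ^ 2) * normBessel (d + 2) s)
    (hr₁ : 0 ≤ r₁) (hr : r₁ ≤ r₂) (hr₂ : r₂ ≤ R) (hm : 0 < m)
    (hum : ∀ s, r₁ ^ 2 ≤ s → s ≤ r₂ ^ 2 → m ≤ normBessel d s) :
    m ^ (q - p) * (e * r₁ ^ (d + 1) / d ^ 2 * m ^ (p - 1) * (r₂ - r₁)) ≤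
      ∫ r in (0 : ℝ)..R, radialIntegrand d q (A + (q - p)) r := by
  have hp' : (2 : ℝ) ≤ p := by exact_mod_cast hp
  have hd' : (1 : ℝ) ≤ d := by exact_mod_cast hd
  set E : ℝ → ℝ := fun s => normBessel d s * ((A + (q - p)) * normBessel (d + 2) s ^ 2 - κ) -
      q * (1 - s / R ^ 2) * normBessel (d + 2) s with hEdef
  -- passing from `p` to `q` adds `(q - p) v (u v - (1 - s/R²)) ≥ 0` to `E`
  have hEe : ∀ s, 0 ≤ s → s ≤ R ^ 2 → e ≤ E s := fun s h0 h1 => by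
    have h2 := hE s h0 h1
    have h3 := mul_nonneg (mul_nonneg (sub_nonneg.2 hq) (hv s h0 h1)) (sub_nonneg.2 (huv s h0 h1))
    simp only [hEdef]
    linarith
  set F : ℝ → ℝ := fun r => |normBessel d (r ^ 2)| ^ (q - 1) * (r ^ (d + 1) / d ^ 2) * E (r ^ 2)
    with hF
  have hcF : Continuous F := by
    have := continuous_radial_rpow hd (q := q - 1) (by linarith)
    have := continuous_radial hd
    have := continuous_radial (d := d + 2) (by omega)
    simp only [hF, hEdef]
    fun_prop
  have hcf := continuous_radialIntegrand (A := A + (q - p)) hd (by linarith : 0 ≤ q)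
  have hsq : ∀ r ∈ Set.Icc 0 R, r ^ 2 ≤ R ^ 2 := fun r h => pow_le_pow_left₀ h.1 h.2 2
  have hG : ∫ r in (0 : ℝ)..R, (F r - radialIntegrand d q (A + (q - p)) r) = 0 := by
    rw [intervalIntegral.integral_eq_sub_of_hasDerivAt
      (f := fun r => (1 / (d : ℝ)) * (r ^ d * (1 - r ^ 2 / R ^ 2) * normBessel d (r ^ 2) ^ q))]
    · rw [div_self (by positivity), zero_pow (by omega)]
      ring
    · intro r hr
      rw [Set.uIcc_of_le hR.le] at hr
      have hpos := hu (r ^ 2) (sq_nonneg r) (hsq r hr)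
      have h1 := (hasDerivAt_radial hd r).rpow_const (p := q) (Or.inl hpos.ne')
      have h2 := ((hasDerivAt_pow 2 r).div_const (R ^ 2)).const_sub 1
      refine ((((hasDerivAt_pow d r).mul h2).mul h1).const_mul _).congr_deriv ?_
      have hq1 : normBessel d (r ^ 2) ^ q =
          normBessel d (r ^ 2) ^ (q - 1) * normBessel d (r ^ 2) := by
        rw [← Real.rpow_add_one hpos.ne']; norm_num
      obtain ⟨n, rfl⟩ : ∃ n, d = n + 1 := ⟨d - 1, by omega⟩
      simp only [hF, hEdef, radialIntegrand, abs_of_pos hpos, hq1, Pi.mul_apply]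
      rw [show κ = ((n + 1 : ℕ) : ℝ) * ((n + 1 : ℕ) + 2) / R ^ 2 by
        rw [← hκ]; field_simp]
      simp only [Nat.add_sub_cancel]
      push_cast
      have : (n : ℝ) + 1 ≠ 0 := by positivity
      field_simp
      ring
    · exact (hcF.sub hcf).intervalIntegrable _ _
  rw [intervalIntegral.integral_sub (hcF.intervalIntegrable _ _) (hcf.intervalIntegrable _ _),
    sub_eq_zero] at hG
  rw [← hG]
  have hmm : m ^ (q - p) * m ^ (p - 1) = m ^ (q - 1) := by
    rw [← Real.rpow_natCast m (p - 1), ← Real.rpow_add hm, Nat.cast_sub (by omega)]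
    congr 1
    push_cast
    ring
  calc m ^ (q - p) * (e * r₁ ^ (d + 1) / d ^ 2 * m ^ (p - 1) * (r₂ - r₁))
      = m ^ (q - 1) * (r₁ ^ (d + 1) / d ^ 2) * e * (r₂ - r₁) := by rw [← hmm]; ring
    _ ≤ _ := by
      refine le_intervalIntegral_of_le_on hcF hr₁ hr hr₂ (fun r hr => ?_) fun r hr => ?_
      · have := he.trans (hEe _ (sq_nonneg r) (hsq r hr))
        have := hr.1
        simp only [hF]
        positivity
      · have h0 : 0 ≤ r := hr₁.trans hr.1
        have h1 := hEe _ (sq_nonneg r) (hsq r ⟨h0, hr.2.trans hr₂⟩)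
        have h2 := hum (r ^ 2) (pow_le_pow_left₀ hr₁ hr.1 2) (pow_le_pow_left₀ h0 hr.2 2)
        simp only [hF]
        have h3 : m ^ (q - 1) ≤ |normBessel d (r ^ 2)| ^ (q - 1) :=
          Real.rpow_le_rpow hm.le (h2.trans (le_abs_self _)) (by linarith)
        have h4 := hr.1
        gcongr

/-- On `[R, S]` the integrand is nonnegative because `A u'² ≥ 1` there, and `A u'² ≥ 1 + g` on
`[r₁, r₂]` gives a quantitative gain. -/
lemma integral_radialIntegrand_middle {R S g r₁ r₂ m : ℝ} (hd : 1 ≤ d)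
    (hq : (p : ℝ) ≤ q) (hR : 0 < R) (hg : 0 ≤ g)
    (hmid : ∀ s, R ^ 2 ≤ s → s ≤ S ^ 2 → (d : ℝ) ^ 2 ≤ A * s * normBessel (d + 2) s ^ 2)
    (hr₁ : R ≤ r₁) (hr : r₁ ≤ r₂) (hr₂ : r₂ ≤ S) (hm : 0 < m)
    (hum : ∀ s, r₁ ^ 2 ≤ s → s ≤ r₂ ^ 2 → m ≤ normBessel d s)
    (hvg : ∀ s, r₁ ^ 2 ≤ s → s ≤ r₂ ^ 2 →
      (d : ℝ) ^ 2 * (1 + g) ≤ A * s * normBessel (d + 2) s ^ 2) :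
    m ^ (q - p) * (g * r₁ ^ (d - 1) * m ^ p * (r₂ - r₁)) ≤
      ∫ r in R..S, radialIntegrand d q (A + (q - p)) r := by
  have hq0 : 0 ≤ q := (Nat.cast_nonneg p).trans hq
  have hd' : (1 : ℝ) ≤ d := by exact_mod_cast hd
  have hmm : m ^ (q - p) * m ^ p = m ^ q := by
    rw [← Real.rpow_natCast m p, ← Real.rpow_add hm]
    congr 1
    ring
  have hfac : ∀ r c : ℝ, (d : ℝ) ^ 2 * c ≤ A * r ^ 2 * normBessel (d + 2) (r ^ 2) ^ 2 →
      c ≤ (A + (q - p)) * (r / d * normBessel (d + 2) (r ^ 2)) ^ 2 := fun r c h => by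
    have h1 : c ≤ A * (r / d * normBessel (d + 2) (r ^ 2)) ^ 2 := by
      rw [mul_pow, div_pow, ← mul_assoc, ← mul_div_assoc, div_mul_eq_mul_div,
        le_div_iff₀ (by positivity)]
      linarith
    have h2 := mul_nonneg (sub_nonneg.2 hq) (sq_nonneg (r / d * normBessel (d + 2) (r ^ 2)))
    linarith
  calc m ^ (q - p) * (g * r₁ ^ (d - 1) * m ^ p * (r₂ - r₁))
      = m ^ q * r₁ ^ (d - 1) * g * (r₂ - r₁) := by rw [← hmm]; ring
    _ ≤ _ := by
      refine le_intervalIntegral_of_le_on (continuous_radialIntegrand hd hq0) hr₁ hr hr₂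
        (fun r hr => ?_) fun r hr => ?_
      · have h0 : 0 < r := hR.trans_le hr.1
        have h1 := hfac r 1 (by
          rw [mul_one]
          exact hmid _ (pow_le_pow_left₀ hR.le hr.1 2) (pow_le_pow_left₀ h0.le hr.2 2))
        have := sub_nonneg.2 h1
        unfold radialIntegrand
        positivity
      · have hr₁0 : 0 < r₁ := hR.trans_le hr₁
        have h0 : 0 < r := hr₁0.trans_le hr.1
        have hs1 := pow_le_pow_left₀ hr₁0.le hr.1 2
        have hs2 := pow_le_pow_left₀ h0.le hr.2 2
        have h1 := hfac r (1 + g) (hvg _ hs1 hs2)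
        have h2 : m ^ q ≤ |normBessel d (r ^ 2)| ^ q :=
          Real.rpow_le_rpow hm.le ((hum _ hs1 hs2).trans (le_abs_self _)) hq0
        have h3 := hr.1
        unfold radialIntegrand
        gcongr
        linarith

/-- Below the level `m`, the `q`-th power is controlled by the `p`-th power up to `m^{q-p}`. -/
lemma neg_le_radialIntegrand {r m B : ℝ} (hq : (p : ℝ) ≤ q) (hp : 1 ≤ p) (hA : 0 ≤ A)
    (hr : 0 ≤ r) (hum : |normBessel d (r ^ 2)| ≤ m)
    (hB : |normBessel d (r ^ 2)| ^ p * r ^ (d - 1) ≤ B) :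
    -(m ^ (q - p) * B) ≤ radialIntegrand d q (A + (q - p)) r := by
  have hp' : (1 : ℝ) ≤ p := by exact_mod_cast hp
  have hsplit : |normBessel d (r ^ 2)| ^ q =
      |normBessel d (r ^ 2)| ^ (q - p) * |normBessel d (r ^ 2)| ^ p := by
    rw [← Real.rpow_natCast _ p,
      ← Real.rpow_add_of_nonneg (abs_nonneg _) (by linarith) (by linarith)]
    congr 1
    ring
  have h1 : |normBessel d (r ^ 2)| ^ q * r ^ (d - 1) ≤ m ^ (q - p) * B := by
    rw [hsplit, mul_assoc]
    have : |normBessel d (r ^ 2)| ^ (q - p) ≤ m ^ (q - p) :=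
      Real.rpow_le_rpow (abs_nonneg _) hum (by linarith)
    have h0 : 0 ≤ m := (abs_nonneg _).trans hum
    gcongr
  have h2 : 0 ≤ |normBessel d (r ^ 2)| ^ q * r ^ (d - 1) *
      ((A + (q - p)) * (r / d * normBessel (d + 2) (r ^ 2)) ^ 2) := by
    have : 0 ≤ A + (q - p) := by linarith
    positivity
  unfold radialIntegrand
  linarith

lemma integrableOn_radialIntegrand (hd : 1 ≤ d) (hp : 1 ≤ p) (hdec : RadialDecay d p)
    (hq : (p : ℝ) ≤ q) : IntegrableOn (radialIntegrand d q A) (Set.Ioi 0) := by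
  refine (((integrableOn_radial_rpow_mul_deriv_sq hd hp hdec hq).const_mul A).sub
    (integrableOn_radial_rpow hd hp hdec hq)).congr (Filter.Eventually.of_forall fun r => ?_)
  simp only [radialIntegrand, Pi.sub_apply]
  ring

/-- Positivity of the radial integral for all `q ≥ p`. The gains `γ₁`, `γ₂` on `[0, R]` and `[R, S]`
and the loss on `[S, ∞)`, where `|u| ≤ m`, all scale with `m^{q-p}`, so that it suffices to compare
them for `q = p`. -/
lemma integral_radialIntegrand_pos {R S T σ τ m U K γ₁ γ₂ : ℝ} {a : ℕ}
    (hd : 1 ≤ d) (hp : 2 ≤ p) (hdec : RadialDecay d p) (hq : (p : ℝ) ≤ q) (hA : 0 ≤ A)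
    (hm : 0 < m) (hcore : m ^ (q - p) * γ₁ ≤ ∫ r in (0 : ℝ)..R, radialIntegrand d q (A + (q - p)) r)
    (hmiddle : m ^ (q - p) * γ₂ ≤ ∫ r in R..S, radialIntegrand d q (A + (q - p)) r)
    (hS : 0 < S) (hST : S ≤ T) (hσ : S ^ 2 = σ) (hτ : T ^ 2 = τ) (hUm : U ≤ m) (ha : 1 ≤ a)
    (hU : ∀ s, σ ≤ s → s ≤ τ → |normBessel d s| ≤ U)
    (htail : ∀ r, T ≤ r → |normBessel d (r ^ 2)| ≤ m ∧
      |normBessel d (r ^ 2)| ^ p * r ^ (d - 1) ≤ K / r ^ (a + 1))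
    (hnum : U ^ p * ((T ^ d - S ^ d) / d) + K / (a * T ^ a) < γ₁ + γ₂) :
    0 < ∫ r in Set.Ioi (0 : ℝ), radialIntegrand d q (A + (q - p)) r := by
  subst hσ hτ
  have hp' : (2 : ℝ) ≤ p := by exact_mod_cast hp
  have hd' : (1 : ℝ) ≤ d := by exact_mod_cast hd
  have ha' : (1 : ℝ) ≤ a := by exact_mod_cast ha
  have hT : 0 < T := hS.trans_le hST
  have hc := continuous_radialIntegrand (A := A + (q - p)) hd (by linarith : 0 ≤ q)
  have hint := integrableOn_radialIntegrand (A := A + (q - p)) hd (by omega) hdec hq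
  have hU0 : 0 ≤ U := (abs_nonneg _).trans (hU (S ^ 2) le_rfl (pow_le_pow_left₀ hS.le hST 2))
  have hlam : 0 < m ^ (q - p) := by positivity
  have hST' : -(m ^ (q - p) * (U ^ p * ((T ^ d - S ^ d) / d))) ≤
      ∫ r in S..T, radialIntegrand d q (A + (q - p)) r := by
    have h1 : ∫ r in S..T, -(m ^ (q - p) * U ^ p) * r ^ (d - 1) =
        -(m ^ (q - p) * (U ^ p * ((T ^ d - S ^ d) / d))) := by
      rw [intervalIntegral.integral_const_mul, integral_pow, Nat.cast_sub hd,
        Nat.sub_add_cancel hd]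
      push_cast
      rw [sub_add_cancel]
      ring
    rw [← h1]
    refine intervalIntegral.integral_mono_on hST ((by fun_prop : Continuous
      fun r : ℝ => -(m ^ (q - p) * U ^ p) * r ^ (d - 1)).intervalIntegrable _ _)
      (hc.intervalIntegrable _ _) fun r hr => ?_
    have h0 : 0 < r := hS.trans_le hr.1
    have h2 := hU (r ^ 2) (pow_le_pow_left₀ hS.le hr.1 2) (pow_le_pow_left₀ h0.le hr.2 2)
    refine le_trans (le_of_eq ?_) (neg_le_radialIntegrand hq (by omega) hA h0.le (h2.trans hUm)
      (mul_le_mul_of_nonneg_right (pow_le_pow_left₀ (abs_nonneg _) h2 p) (by positivity)))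
    ring
  have hTail : -(m ^ (q - p) * (K / (a * T ^ a))) ≤
      ∫ r in Set.Ioi T, radialIntegrand d q (A + (q - p)) r := by
    have hrp : ∀ r : ℝ, 0 < r → r ^ (-((a : ℝ) + 1)) = 1 / r ^ (a + 1) := fun r hr => by
      rw [Real.rpow_neg hr.le, ← Nat.cast_succ, Real.rpow_natCast, one_div]
    have h1 : ∫ r in Set.Ioi T, -(m ^ (q - p) * K) * r ^ (-((a : ℝ) + 1)) =
        -(m ^ (q - p) * (K / (a * T ^ a))) := by
      rw [integral_const_mul, integral_Ioi_rpow_of_lt (by linarith) hT,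
        show -((a : ℝ) + 1) + 1 = -(a : ℝ) by ring, Real.rpow_neg hT.le, Real.rpow_natCast]
      field_simp
    rw [← h1]
    refine setIntegral_mono_on ((integrableOn_Ioi_rpow_of_lt (by linarith) hT).const_mul _)
      (hint.mono_set (Set.Ioi_subset_Ioi hT.le)) measurableSet_Ioi fun r hr => ?_
    have h0 : 0 < r := hT.trans hr
    obtain ⟨h2, h3⟩ := htail r (le_of_lt hr)
    refine le_trans (le_of_eq ?_) (neg_le_radialIntegrand hq (by omega) hA h0.le h2 h3)
    rw [hrp r h0]
    ring
  have hii : ∀ x y : ℝ, IntervalIntegrable (radialIntegrand d q (A + (q - p))) volume x y :=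
    fun x y => hc.intervalIntegrable x y
  have hsum : ∫ r in Set.Ioi (0 : ℝ), radialIntegrand d q (A + (q - p)) r =
      (∫ r in (0 : ℝ)..R, radialIntegrand d q (A + (q - p)) r) +
      (∫ r in R..S, radialIntegrand d q (A + (q - p)) r) +
      (∫ r in S..T, radialIntegrand d q (A + (q - p)) r) +
      ∫ r in Set.Ioi T, radialIntegrand d q (A + (q - p)) r := by
    rw [intervalIntegral.integral_add_adjacent_intervals (hii _ _) (hii _ _),
      intervalIntegral.integral_add_adjacent_intervals (hii _ _) (hii _ _),
      intervalIntegral.integral_of_le hT.le,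
      ← setIntegral_union Set.Ioc_disjoint_Ioi_same measurableSet_Ioi
        (hint.mono_set Set.Ioc_subset_Ioi_self) (hint.mono_set (Set.Ioi_subset_Ioi hT.le)),
      Set.Ioc_union_Ioi_eq_Ioi hT.le]
  have := mul_lt_mul_of_pos_left hnum hlam
  rw [hsum]
  linarith

end Positivity

/-! ### Gain and loss from explicit bounds -/

/-- Nonnegativity of the Bernstein basis polynomials of `[a, b]`. A polynomial is shown to be
nonnegative on `[a, b]` by writing it as a combination of these with nonnegative coefficients. -/
lemma bernsteinBasis_nonneg {a b s : ℝ} (h0 : a ≤ s) (h1 : s ≤ b) (i j : ℕ) :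
    0 ≤ (s - a) ^ i * (b - s) ^ j :=
  mul_nonneg (pow_nonneg (sub_nonneg.2 h0) i) (pow_nonneg (sub_nonneg.2 h1) j)

/-- The expression `u (A v² - κ) - p ℓ v` may be bounded below by inserting lower bounds of `u` and
of `v`: it increases in `u` since `A v² ≥ κ`, and in `v` since `u v ≥ ℓ`. -/
lemma core_le_of_le {u v x y A κ e p ℓ : ℝ} (hx : 0 < x) (hxu : x ≤ u) (hy : 0 ≤ y) (hyv : y ≤ v)
    (hℓ : ℓ ≤ x * y) (hκ : κ ≤ A * y ^ 2) (hp : 0 ≤ p) (hpA : p ≤ A)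
    (he : e ≤ x * (A * y ^ 2 - κ) - p * ℓ * y) :
    e ≤ u * (A * v ^ 2 - κ) - p * ℓ * v := by
  have hA : 0 ≤ A := hp.trans hpA
  have h1 : A * y ^ 2 ≤ A * v ^ 2 := by gcongr
  have h2 : x * (A * v ^ 2 - κ) ≤ u * (A * v ^ 2 - κ) :=
    mul_le_mul_of_nonneg_right hxu (by linarith)
  have h3 : p * ℓ ≤ A * x * (v + y) := by
    have h4 : p * ℓ ≤ p * (x * y) := by gcongr
    have h5 : p * (x * y) ≤ A * (x * y) := by gcongr
    have h6 : 0 ≤ A * x * v := by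
      have := hy.trans hyv
      positivity
    linarith
  have h7 := mul_nonneg (sub_nonneg.2 hyv) (sub_nonneg.2 h3)
  linarith

section Bounds

variable {d p : ℕ} {q A : ℝ}

/-- The gain on `[0, R]`, with lower bounds `x` and `y` in place of `normBessel d` and
`normBessel (d + 2)`. -/
lemma integral_radialIntegrand_core_of_bounds {R κ e r₁ r₂ m s₀ s₁ s₂ γ : ℝ} {x y : ℝ → ℝ}
    (hq : (p : ℝ) ≤ q) (hx : ∀ s, 0 ≤ s → x s ≤ normBessel d s)
    (hy : ∀ s, 0 ≤ s → y s ≤ normBessel (d + 2) s)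
    (hpos : ∀ s, 0 ≤ s → s ≤ s₀ → 0 < x s ∧ 0 ≤ y s)
    (hxy : ∀ s, 0 ≤ s → s ≤ s₀ → 1 - s / s₀ ≤ x s * y s)
    (hκy : ∀ s, 0 ≤ s → s ≤ s₀ → κ ≤ A * y s ^ 2)
    (hE : ∀ s, 0 ≤ s → s ≤ s₀ → e ≤ x s * (A * y s ^ 2 - κ) - p * (1 - s / s₀) * y s)
    (hxm : ∀ s, s₁ ≤ s → s ≤ s₂ → m ≤ x s)
    (hd : 1 ≤ d) (hp : 2 ≤ p) (hpA : p ≤ A) (hR : 0 < R) (hs₀ : R ^ 2 = s₀)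
    (hκ : κ * s₀ = d * (d + 2)) (he : 0 ≤ e) (hm : 0 < m)
    (hr₁ : 0 ≤ r₁) (hr : r₁ ≤ r₂) (hr₂ : r₂ ≤ R) (hs₁ : r₁ ^ 2 = s₁) (hs₂ : r₂ ^ 2 = s₂)
    (hγ : γ = e * r₁ ^ (d + 1) / d ^ 2 * m ^ (p - 1) * (r₂ - r₁)) :
    m ^ (q - p) * γ ≤ ∫ r in (0 : ℝ)..R, radialIntegrand d q (A + (q - p)) r := by
  subst hs₀ hs₁ hs₂ hγ
  refine integral_radialIntegrand_core hd hp hq hR hκ he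
    (fun s h0 h1 => (hpos s h0 h1).1.trans_le (hx s h0))
    (fun s h0 h1 => (hpos s h0 h1).2.trans (hy s h0))
    (fun s h0 h1 => (hxy s h0 h1).trans ?_)
    (fun s h0 h1 => core_le_of_le (hpos s h0 h1).1 (hx s h0) (hpos s h0 h1).2 (hy s h0)
      (hxy s h0 h1) (hκy s h0 h1) (Nat.cast_nonneg p) hpA (hE s h0 h1))
    hr₁ hr hr₂ hm (fun s h0 h1 => (hxm s h0 h1).trans (hx s ((sq_nonneg r₁).trans h0)))
  exact mul_le_mul (hx s h0) (hy s h0) (hpos s h0 h1).2 ((hpos s h0 h1).1.le.trans (hx s h0))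

lemma integral_radialIntegrand_middle_nonneg {R S s₀ σ : ℝ} {y : ℝ → ℝ}
    (hq : (p : ℝ) ≤ q) (hy : ∀ s, 0 ≤ s → y s ≤ normBessel (d + 2) s)
    (hmid : ∀ s, s₀ ≤ s → s ≤ σ → 0 ≤ y s ∧ (d : ℝ) ^ 2 ≤ A * s * y s ^ 2)
    (hd : 1 ≤ d) (hA : 0 ≤ A) (hR : 0 < R) (hRS : R ≤ S) (hs₀ : R ^ 2 = s₀) (hσ : S ^ 2 = σ) :
    0 ≤ ∫ r in R..S, radialIntegrand d q (A + (q - p)) r := by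
  subst hs₀ hσ
  refine intervalIntegral.integral_nonneg hRS fun r hr => ?_
  have hd' : (1 : ℝ) ≤ d := by exact_mod_cast hd
  have h0 : 0 < r := hR.trans_le hr.1
  obtain ⟨h1, h2⟩ := hmid (r ^ 2) (pow_le_pow_left₀ hR.le hr.1 2) (pow_le_pow_left₀ h0.le hr.2 2)
  have h3 : A * r ^ 2 * y (r ^ 2) ^ 2 ≤ A * r ^ 2 * normBessel (d + 2) (r ^ 2) ^ 2 := by
    have := hy (r ^ 2) (sq_nonneg r)
    gcongr
  have h4 : 1 ≤ A * (r / d * normBessel (d + 2) (r ^ 2)) ^ 2 := by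
    rw [mul_pow, div_pow, ← mul_assoc, ← mul_div_assoc, div_mul_eq_mul_div,
      le_div_iff₀ (by positivity)]
    linarith
  have h5 := mul_nonneg (sub_nonneg.2 hq) (sq_nonneg (r / d * normBessel (d + 2) (r ^ 2)))
  have h6 : 0 ≤ (A + (q - p)) * (r / d * normBessel (d + 2) (r ^ 2)) ^ 2 - 1 := by linarith
  unfold radialIntegrand
  positivity

/-- The tail in dimensions `3 ≤ d ≤ 7`, from bounds on `u` and `(r u)'` at the single point `T`:
`r² u² ≤ N` for `r ≥ T`, whose fourth power leaves `r^{d-1-8} = r^{-(a+1)}`. -/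
lemma tail_of_three_le {T τ x y N m : ℝ} {a : ℕ} (hd : 3 ≤ d) (ha : a + d = 8) (hT : 0 < T)
    (hτ : T ^ 2 = τ) (hx : |normBessel d τ| ≤ x)
    (hy : |normBessel d τ - τ / d * normBessel (d + 2) τ| ≤ y)
    (hN : (τ + (d - 3)) * x ^ 2 + y ^ 2 ≤ N) (hm : 0 ≤ m) (hNm : N ≤ m ^ 2 * τ) :
    ∀ r, T ≤ r → |normBessel d (r ^ 2)| ≤ m ∧
      |normBessel d (r ^ 2)| ^ 8 * r ^ (d - 1) ≤ N ^ 4 / r ^ (a + 1) := by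
  intro r hr
  subst hτ
  have hr0 : 0 < r := hT.trans_le hr
  have hd' : (3 : ℝ) ≤ d := by exact_mod_cast hd
  have h1 : normBessel d (T ^ 2) ^ 2 ≤ x ^ 2 := sq_le_sq' (neg_le_of_abs_le hx) (le_of_abs_le hx)
  have h2 : (normBessel d (T ^ 2) - T ^ 2 / d * normBessel (d + 2) (T ^ 2)) ^ 2 ≤ y ^ 2 :=
    sq_le_sq' (neg_le_of_abs_le hy) (le_of_abs_le hy)
  have h3 : r ^ 2 * normBessel d (r ^ 2) ^ 2 ≤ N := by
    refine (sq_mul_radial_sq_le hd hT.le hr).trans ?_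
    have h4 : 0 ≤ T ^ 2 + ((d : ℝ) - 3) := by nlinarith [sq_nonneg T]
    have h5 := mul_le_mul_of_nonneg_left h1 h4
    linarith
  constructor
  · have h4 : r ^ 2 * normBessel d (r ^ 2) ^ 2 ≤ r ^ 2 * m ^ 2 := by
      have : m ^ 2 * T ^ 2 ≤ m ^ 2 * r ^ 2 := by gcongr
      linarith
    exact abs_le_of_sq_le_sq (le_of_mul_le_mul_left h4 (by positivity)) hm
  · rw [le_div_iff₀ (by positivity)]
    calc |normBessel d (r ^ 2)| ^ 8 * r ^ (d - 1) * r ^ (a + 1)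
        = |normBessel d (r ^ 2)| ^ 8 * r ^ 8 := by
          rw [mul_assoc, ← pow_add, show d - 1 + (a + 1) = 8 by omega]
      _ = (r ^ 2 * normBessel d (r ^ 2) ^ 2) ^ 4 := by
          rw [← sq_abs (normBessel d (r ^ 2))]; ring
      _ ≤ N ^ 4 := by gcongr

/-- The tail in dimension `2`, from bounds on `u` and `r^{-1/2} (√r u)'` at the single point `T`:
`r u² ≤ N` for `r ≥ T`, whose sixth power leaves `r^{1-6} = r^{-(4+1)}`. -/
lemma tail_two {T τ x y N m : ℝ} (hT : 0 < T) (hτ : T ^ 2 = τ)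
    (hx : |normBessel 2 τ| ≤ x) (hy : |T / 2 * normBessel 4 τ - normBessel 2 τ / (2 * T)| ≤ y)
    (hN : T * (x ^ 2 + y ^ 2) + x ^ 2 / (4 * T) ≤ N) (hm : 0 ≤ m) (hNm : N ≤ m ^ 2 * T) :
    ∀ r, T ≤ r → |normBessel 2 (r ^ 2)| ≤ m ∧
      |normBessel 2 (r ^ 2)| ^ 12 * r ^ (2 - 1) ≤ N ^ 6 / r ^ (4 + 1) := by
  intro r hr
  subst hτ
  have hr0 : 0 < r := hT.trans_le hr
  have h1 : normBessel 2 (T ^ 2) ^ 2 ≤ x ^ 2 := sq_le_sq' (neg_le_of_abs_le hx) (le_of_abs_le hx)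
  have h2 : (T / 2 * normBessel 4 (T ^ 2) - normBessel 2 (T ^ 2) / (2 * T)) ^ 2 ≤ y ^ 2 :=
    sq_le_sq' (neg_le_of_abs_le hy) (le_of_abs_le hy)
  have h3 : r * normBessel 2 (r ^ 2) ^ 2 ≤ N := by
    refine (mul_radial_two_sq_le hT hr).trans (le_trans ?_ hN)
    have h4 : T * (normBessel 2 (T ^ 2) ^ 2 + (T / 2 * normBessel 4 (T ^ 2)) ^ 2) -
        T / 2 * normBessel 2 (T ^ 2) * normBessel 4 (T ^ 2) +
          normBessel 2 (T ^ 2) ^ 2 / (2 * T) =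
        T * (normBessel 2 (T ^ 2) ^ 2 +
          (T / 2 * normBessel 4 (T ^ 2) - normBessel 2 (T ^ 2) / (2 * T)) ^ 2) +
        normBessel 2 (T ^ 2) ^ 2 / (4 * T) := by
      field_simp
      ring
    rw [h4]
    gcongr
  constructor
  · have h4 : r * normBessel 2 (r ^ 2) ^ 2 ≤ r * m ^ 2 := by
      have : m ^ 2 * T ≤ m ^ 2 * r := by gcongr
      linarith
    exact abs_le_of_sq_le_sq (le_of_mul_le_mul_left h4 hr0) hm
  · rw [le_div_iff₀ (by positivity)]
    calc |normBessel 2 (r ^ 2)| ^ 12 * r ^ (2 - 1) * r ^ (4 + 1)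
        = (r * normBessel 2 (r ^ 2) ^ 2) ^ 6 := by
          rw [← sq_abs (normBessel 2 (r ^ 2))]; ring
      _ ≤ N ^ 6 := by gcongr

end Bounds

/-! ### Numerical bounds in dimensions two to seven -/

/-- Case `d = 2`: at `q = 12` the gain on `[0, R]` is at least `4.7·10⁻⁴`, and the loss on `[S, ∞)`
at most `1.4·10⁻⁴`. -/
lemma integral_radialIntegrand_pos_two {q : ℝ} (hq : ((12 : ℕ) : ℝ) ≤ q) :
    0 < ∫ r in Set.Ioi (0 : ℝ), radialIntegrand 2 q (16 + (q - (12 : ℕ))) r := by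
  have hx : ∀ s : ℝ, 0 ≤ s → 1 - s / 4 + s ^ 2 / 64 - s ^ 3 / 2304 ≤ normBessel 2 s :=
      fun s hs =>
    le_of_eq_of_le (by
      norm_num [besselPartial, besselCoeff, Finset.sum_range_succ, Finset.prod_range_succ]
      ring)
      (besselPartial_le_normBessel 1 (by norm_num) hs)
  have hy : ∀ s : ℝ, 0 ≤ s → 1 - s / 8 + s ^ 2 / 192 - s ^ 3 / 9216 ≤ normBessel 4 s :=
      fun s hs =>
    le_of_eq_of_le (by
      norm_num [besselPartial, besselCoeff, Finset.sum_range_succ, Finset.prod_range_succ]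
      ring)
      (besselPartial_le_normBessel 1 (by norm_num) hs)
  have hy' : ∀ s : ℝ, 0 ≤ s → 1 - s / 8 + s ^ 2 / 192 - s ^ 3 / 9216 + s ^ 4 / 737280 -
      s ^ 5 / 88473600 ≤ normBessel 4 s := fun s hs =>
    le_of_eq_of_le (by
      norm_num [besselPartial, besselCoeff, Finset.sum_range_succ, Finset.prod_range_succ]
      ring)
      (besselPartial_le_normBessel 2 (by norm_num) hs)
  have hU : ∀ s : ℝ, 101761 / 10000 ≤ s → s ≤ 361 / 25 → |normBessel 2 s| ≤ 41 / 100 := by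
    intro s h0 h1
    have hb := bernsteinBasis_nonneg h0 h1
    have h2 := besselPartial_le_normBessel 2 (d := 2) (by norm_num) (by linarith : 0 ≤ s)
    have h3 := normBessel_le_besselPartial 2 (d := 2) (by norm_num) (by linarith : 0 ≤ s)
    norm_num [besselPartial, besselCoeff, Finset.sum_range_succ, Finset.prod_range_succ] at h2 h3
    refine abs_le.2 ⟨?_, ?_⟩
    · linarith [hb 0 6, hb 1 5, hb 2 4, hb 3 3, hb 4 2, hb 5 1, hb 6 0]
    · linarith [hb 0 5, hb 1 4, hb 2 3, hb 3 2, hb 4 1, hb 5 0]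
  have hul : -2013 / 5000 ≤ normBessel 2 (361 / 25) :=
    le_trans (by
        norm_num [besselPartial, besselCoeff, Finset.sum_range_succ, Finset.prod_range_succ])
      (besselPartial_le_normBessel 3 (by norm_num) (by norm_num))
  have huu : normBessel 2 (361 / 25) ≤ -161 / 400 :=
    le_trans (normBessel_le_besselPartial 4 (by norm_num) (by norm_num))
      (by
        norm_num [besselPartial, besselCoeff, Finset.sum_range_succ, Finset.prod_range_succ])
  have hvl : 67 / 10000 ≤ normBessel 4 (361 / 25) :=
    le_trans (by
        norm_num [besselPartial, besselCoeff, Finset.sum_range_succ, Finset.prod_range_succ])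
      (besselPartial_le_normBessel 3 (by norm_num) (by norm_num))
  have hvu : normBessel 4 (361 / 25) ≤ 17 / 2500 :=
    le_trans (normBessel_le_besselPartial 3 (by norm_num) (by norm_num))
      (by
        norm_num [besselPartial, besselCoeff, Finset.sum_range_succ, Finset.prod_range_succ])
  have hy₁ : |(19 / 5) / 2 * normBessel 4 (361 / 25) - normBessel 2 (361 / 25) / (2 * (19 / 5))|
      ≤ 33 / 500 := by
    rw [show (19 / 5) / 2 * normBessel 4 (361 / 25) - normBessel 2 (361 / 25) / (2 * (19 / 5)) =
      (19 / 10) * normBessel 4 (361 / 25) - (5 / 38) * normBessel 2 (361 / 25) by ring]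
    exact abs_le.2 ⟨by linarith, by linarith⟩
  have htail := tail_two (T := 19 / 5) (τ := 361 / 25) (x := 2013 / 5000) (y := 33 / 500)
      (N := 161 / 250)
    (m := 21 / 25) (by norm_num) (by norm_num) (abs_le.2 ⟨by linarith, by linarith⟩)
    hy₁ (by norm_num) (by norm_num) (by norm_num)
  have hcore := integral_radialIntegrand_core_of_bounds (d := 2) (p := 12) (A := 16) (R := 8 / 5)
    (κ := 25 / 8) (e := 3 / 10) (r₁ := 3 / 5) (r₂ := 4 / 5) (m := 21 / 25) (s₀ := 64 / 25)
    (s₁ := 9 / 25) (s₂ := 16 / 25)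
    (γ := (3 / 10) * (3 / 5) ^ 3 / 2 ^ 2 * (21 / 25) ^ 11 * ((4 / 5) - (3 / 5)))
    hq hx hy ?hpos ?hxy ?hκy ?hE ?hxm (by norm_num) (by norm_num) (by norm_num) (by norm_num)
    (by norm_num) (by norm_num) (by norm_num) (by norm_num) (by norm_num) (by norm_num)
    (by norm_num)
    (by norm_num) (by norm_num) (by norm_num)
  case hpos =>
    intro s h0 h1
    have hb := bernsteinBasis_nonneg h0 h1
    simp only [sub_zero] at hb
    constructor
    · linarith [hb 0 4, hb 1 3, hb 2 2, hb 3 1, hb 4 0]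
    · linarith [hb 0 4, hb 1 3, hb 2 2, hb 3 1, hb 4 0]
  case hxy =>
    intro s h0 h1
    have hb := bernsteinBasis_nonneg h0 h1
    simp only [sub_zero] at hb
    linarith [hb 0 7, hb 1 6, hb 2 5, hb 3 4, hb 4 3, hb 5 2, hb 6 1, hb 7 0]
  case hκy =>
    intro s h0 h1
    have hb := bernsteinBasis_nonneg h0 h1
    simp only [sub_zero] at hb
    linarith [hb 0 7, hb 1 6, hb 2 5, hb 3 4, hb 4 3, hb 5 2, hb 6 1, hb 7 0]
  case hE =>
    intro s h0 h1
    have hb := bernsteinBasis_nonneg h0 h1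
    simp only [sub_zero] at hb
    push_cast
    linarith [hb 0 10, hb 1 9, hb 2 8, hb 3 7, hb 4 6, hb 5 5, hb 6 4, hb 7 3, hb 8 2, hb 9 1,
      hb 10 0]
  case hxm =>
    intro s h0 h1
    have hb := bernsteinBasis_nonneg h0 h1
    linarith [hb 0 4, hb 1 3, hb 2 2, hb 3 1, hb 4 0]
  have hmiddle := integral_radialIntegrand_middle_nonneg (d := 2) (A := 16) (R := 8 / 5)
      (S := 319 / 100)
    (s₀ := 64 / 25) (σ := 101761 / 10000) hq hy' ?hmid (by norm_num) (by norm_num) (by norm_num)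
    (by norm_num) (by norm_num) (by norm_num)
  case hmid =>
    intro s h0 h1
    have hb := bernsteinBasis_nonneg h0 h1
    push_cast
    constructor
    · linarith [hb 0 6, hb 1 5, hb 2 4, hb 3 3, hb 4 2, hb 5 1, hb 6 0]
    · linarith [hb 0 12, hb 1 11, hb 2 10, hb 3 9, hb 4 8, hb 5 7, hb 6 6, hb 7 5, hb 8 4,
        hb 9 3, hb 10 2, hb 11 1, hb 12 0]
  exact integral_radialIntegrand_pos (γ₂ := 0) (by norm_num) (by norm_num)
    radialDecay_two hq (by norm_num)
    (by norm_num) hcore (by simpa using hmiddle) (by norm_num) (by norm_num) (by norm_num)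
    (by norm_num)
    (by norm_num) (by norm_num) hU htail (by norm_num)

/-- Case `d = 3`: at `q = 8` the gain on `[0, R]` is at least `1.6·10⁻³`, and the loss on `[S, ∞)`
at most `2.1·10⁻⁴`. -/
lemma integral_radialIntegrand_pos_three {q : ℝ} (hq : ((8 : ℕ) : ℝ) ≤ q) :
    0 < ∫ r in Set.Ioi (0 : ℝ), radialIntegrand 3 q (14 + (q - (8 : ℕ))) r := by
  have hx : ∀ s : ℝ, 0 ≤ s → 1 - s / 6 + s ^ 2 / 120 - s ^ 3 / 5040 ≤ normBessel 3 s :=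
      fun s hs =>
    le_of_eq_of_le (by
      norm_num [besselPartial, besselCoeff, Finset.sum_range_succ, Finset.prod_range_succ]
      ring)
      (besselPartial_le_normBessel 1 (by norm_num) hs)
  have hy : ∀ s : ℝ, 0 ≤ s → 1 - s / 10 + s ^ 2 / 280 - s ^ 3 / 15120 ≤ normBessel 5 s :=
      fun s hs =>
    le_of_eq_of_le (by
      norm_num [besselPartial, besselCoeff, Finset.sum_range_succ, Finset.prod_range_succ]
      ring)
      (besselPartial_le_normBessel 1 (by norm_num) hs)
  have hU : ∀ s : ℝ, 1089 / 100 ≤ s → s ≤ 441 / 25 → |normBessel 3 s| ≤ 21 / 100 := by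
    intro s h0 h1
    have hb := bernsteinBasis_nonneg h0 h1
    have h2 := besselPartial_le_normBessel 3 (d := 3) (by norm_num) (by linarith : 0 ≤ s)
    have h3 := normBessel_le_besselPartial 2 (d := 3) (by norm_num) (by linarith : 0 ≤ s)
    norm_num [besselPartial, besselCoeff, Finset.sum_range_succ, Finset.prod_range_succ] at h2 h3
    refine abs_le.2 ⟨?_, ?_⟩
    · linarith [hb 0 8, hb 1 7, hb 2 6, hb 3 5, hb 4 4, hb 5 3, hb 6 2, hb 7 1, hb 8 0]
    · linarith [hb 0 5, hb 1 4, hb 2 3, hb 3 2, hb 4 1, hb 5 0]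
  have hul : -519 / 2500 ≤ normBessel 3 (441 / 25) :=
    le_trans (by
        norm_num [besselPartial, besselCoeff, Finset.sum_range_succ, Finset.prod_range_succ])
      (besselPartial_le_normBessel 3 (by norm_num) (by norm_num))
  have huu : normBessel 3 (441 / 25) ≤ -83 / 400 :=
    le_trans (normBessel_le_besselPartial 4 (by norm_num) (by norm_num))
      (by
        norm_num [besselPartial, besselCoeff, Finset.sum_range_succ, Finset.prod_range_succ])
  have hvl : 6 / 125 ≤ normBessel 5 (441 / 25) :=
    le_trans (by
        norm_num [besselPartial, besselCoeff, Finset.sum_range_succ, Finset.prod_range_succ])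
      (besselPartial_le_normBessel 3 (by norm_num) (by norm_num))
  have hvu : normBessel 5 (441 / 25) ≤ 481 / 10000 :=
    le_trans (normBessel_le_besselPartial 4 (by norm_num) (by norm_num))
      (by
        norm_num [besselPartial, besselCoeff, Finset.sum_range_succ, Finset.prod_range_succ])
  have hy₁ : |normBessel 3 (441 / 25) - (441 / 25) / 3 * normBessel 5 (441 / 25)| ≤ 491 / 1000 :=
    abs_le.2 ⟨by linarith, by linarith⟩
  have htail := tail_of_three_le (d := 3) (a := 5) (T := 21 / 5) (τ := 441 / 25)
      (x := 519 / 2500) (y := 491 / 1000)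
    (N := 501 / 500) (m := 7 / 10) (by norm_num) (by norm_num) (by norm_num) (by norm_num)
    (abs_le.2 ⟨by linarith, by linarith⟩) (by exact_mod_cast hy₁) (by norm_num) (by norm_num)
    (by norm_num)
  have hcore := integral_radialIntegrand_core_of_bounds (d := 3) (p := 8) (A := 14) (R := 37 / 20)
    (κ := 6000 / 1369) (e := 2 / 5) (r₁ := 11 / 10) (r₂ := 7 / 5) (m := 7 / 10) (s₀ := 1369 / 400)
    (s₁ := 121 / 100) (s₂ := 49 / 25)
    (γ := (2 / 5) * (11 / 10) ^ 4 / 3 ^ 2 * (7 / 10) ^ 7 * ((7 / 5) - (11 / 10)))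
    hq hx hy ?hpos ?hxy ?hκy ?hE ?hxm (by norm_num) (by norm_num) (by norm_num) (by norm_num)
    (by norm_num) (by norm_num) (by norm_num) (by norm_num) (by norm_num) (by norm_num)
    (by norm_num)
    (by norm_num) (by norm_num) (by norm_num)
  case hpos =>
    intro s h0 h1
    have hb := bernsteinBasis_nonneg h0 h1
    simp only [sub_zero] at hb
    constructor
    · linarith [hb 0 4, hb 1 3, hb 2 2, hb 3 1, hb 4 0]
    · linarith [hb 0 4, hb 1 3, hb 2 2, hb 3 1, hb 4 0]
  case hxy =>
    intro s h0 h1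
    have hb := bernsteinBasis_nonneg h0 h1
    simp only [sub_zero] at hb
    linarith [hb 0 7, hb 1 6, hb 2 5, hb 3 4, hb 4 3, hb 5 2, hb 6 1, hb 7 0]
  case hκy =>
    intro s h0 h1
    have hb := bernsteinBasis_nonneg h0 h1
    simp only [sub_zero] at hb
    linarith [hb 0 7, hb 1 6, hb 2 5, hb 3 4, hb 4 3, hb 5 2, hb 6 1, hb 7 0]
  case hE =>
    intro s h0 h1
    have hb := bernsteinBasis_nonneg h0 h1
    simp only [sub_zero] at hb
    push_cast
    linarith [hb 0 10, hb 1 9, hb 2 8, hb 3 7, hb 4 6, hb 5 5, hb 6 4, hb 7 3, hb 8 2, hb 9 1,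
      hb 10 0]
  case hxm =>
    intro s h0 h1
    have hb := bernsteinBasis_nonneg h0 h1
    linarith [hb 0 4, hb 1 3, hb 2 2, hb 3 1, hb 4 0]
  have hmiddle := integral_radialIntegrand_middle_nonneg (d := 3) (A := 14) (R := 37 / 20)
      (S := 33 / 10)
    (s₀ := 1369 / 400) (σ := 1089 / 100) hq hy ?hmid (by norm_num) (by norm_num) (by norm_num)
    (by norm_num) (by norm_num) (by norm_num)
  case hmid =>
    intro s h0 h1
    have hb := bernsteinBasis_nonneg h0 h1
    push_cast
    constructor
    · linarith [hb 0 4, hb 1 3, hb 2 2, hb 3 1, hb 4 0]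
    · linarith [hb 0 8, hb 1 7, hb 2 6, hb 3 5, hb 4 4, hb 5 3, hb 6 2, hb 7 1, hb 8 0]
  exact integral_radialIntegrand_pos (γ₂ := 0) (by norm_num) (by norm_num)
    (radialDecay_of_three_le (by norm_num) (by norm_num)) hq (by norm_num)
    (by norm_num) hcore (by simpa using hmiddle) (by norm_num) (by norm_num) (by norm_num)
    (by norm_num)
    (by norm_num) (by norm_num) hU htail (by norm_num)

/-- Case `d = 4`: at `q = 8` the gain on `[0, R]` is at least `5.9·10⁻⁴`, and the loss on `[S, ∞)`
at most `4.1·10⁻⁵`. -/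
lemma integral_radialIntegrand_pos_four {q : ℝ} (hq : ((8 : ℕ) : ℝ) ≤ q) :
    0 < ∫ r in Set.Ioi (0 : ℝ), radialIntegrand 4 q (15 + (q - (8 : ℕ))) r := by
  have hx : ∀ s : ℝ, 0 ≤ s → 1 - s / 8 + s ^ 2 / 192 - s ^ 3 / 9216 ≤ normBessel 4 s :=
      fun s hs =>
    le_of_eq_of_le (by
      norm_num [besselPartial, besselCoeff, Finset.sum_range_succ, Finset.prod_range_succ]
      ring)
      (besselPartial_le_normBessel 1 (by norm_num) hs)
  have hy : ∀ s : ℝ, 0 ≤ s → 1 - s / 12 + s ^ 2 / 384 - s ^ 3 / 23040 ≤ normBessel 6 s :=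
      fun s hs =>
    le_of_eq_of_le (by
      norm_num [besselPartial, besselCoeff, Finset.sum_range_succ, Finset.prod_range_succ]
      ring)
      (besselPartial_le_normBessel 1 (by norm_num) hs)
  have hU : ∀ s : ℝ, 289 / 25 ≤ s → s ≤ 529 / 25 → |normBessel 4 s| ≤ 3 / 25 := by
    intro s h0 h1
    have hb := bernsteinBasis_nonneg h0 h1
    have h2 := besselPartial_le_normBessel 2 (d := 4) (by norm_num) (by linarith : 0 ≤ s)
    have h3 := normBessel_le_besselPartial 2 (d := 4) (by norm_num) (by linarith : 0 ≤ s)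
    norm_num [besselPartial, besselCoeff, Finset.sum_range_succ, Finset.prod_range_succ] at h2 h3
    refine abs_le.2 ⟨?_, ?_⟩
    · linarith [hb 0 6, hb 1 5, hb 2 4, hb 3 3, hb 4 2, hb 5 1, hb 6 0]
    · linarith [hb 0 5, hb 1 4, hb 2 3, hb 3 2, hb 4 1, hb 5 0]
  have hul : -279 / 2500 ≤ normBessel 4 (529 / 25) :=
    le_trans (by
        norm_num [besselPartial, besselCoeff, Finset.sum_range_succ, Finset.prod_range_succ])
      (besselPartial_le_normBessel 3 (by norm_num) (by norm_num))
  have huu : normBessel 4 (529 / 25) ≤ -223 / 2000 :=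
    le_trans (normBessel_le_besselPartial 4 (by norm_num) (by norm_num))
      (by
        norm_num [besselPartial, besselCoeff, Finset.sum_range_succ, Finset.prod_range_succ])
  have hvl : 697 / 10000 ≤ normBessel 6 (529 / 25) :=
    le_trans (by
        norm_num [besselPartial, besselCoeff, Finset.sum_range_succ, Finset.prod_range_succ])
      (besselPartial_le_normBessel 3 (by norm_num) (by norm_num))
  have hvu : normBessel 6 (529 / 25) ≤ 349 / 5000 :=
    le_trans (normBessel_le_besselPartial 4 (by norm_num) (by norm_num))
      (by
        norm_num [besselPartial, besselCoeff, Finset.sum_range_succ, Finset.prod_range_succ])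
  have hy₁ : |normBessel 4 (529 / 25) - (529 / 25) / 4 * normBessel 6 (529 / 25)| ≤ 481 / 1000 :=
    abs_le.2 ⟨by linarith, by linarith⟩
  have htail := tail_of_three_le (d := 4) (a := 4) (T := 23 / 5) (τ := 529 / 25)
      (x := 279 / 2500) (y := 481 / 1000)
    (N := 127 / 250) (m := 16 / 25) (by norm_num) (by norm_num) (by norm_num) (by norm_num)
    (abs_le.2 ⟨by linarith, by linarith⟩) (by exact_mod_cast hy₁) (by norm_num) (by norm_num)
    (by norm_num)
  have hcore := integral_radialIntegrand_core_of_bounds (d := 4) (p := 8) (A := 15) (R := 2)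
    (κ := 6) (e := 1 / 10) (r₁ := 7 / 5) (r₂ := 9 / 5) (m := 16 / 25) (s₀ := 4)
    (s₁ := 49 / 25) (s₂ := 81 / 25)
    (γ := (1 / 10) * (7 / 5) ^ 5 / 4 ^ 2 * (16 / 25) ^ 7 * ((9 / 5) - (7 / 5)))
    hq hx hy ?hpos ?hxy ?hκy ?hE ?hxm (by norm_num) (by norm_num) (by norm_num) (by norm_num)
    (by norm_num) (by norm_num) (by norm_num) (by norm_num) (by norm_num) (by norm_num)
    (by norm_num)
    (by norm_num) (by norm_num) (by norm_num)
  case hpos =>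
    intro s h0 h1
    have hb := bernsteinBasis_nonneg h0 h1
    simp only [sub_zero] at hb
    constructor
    · linarith [hb 0 4, hb 1 3, hb 2 2, hb 3 1, hb 4 0]
    · linarith [hb 0 4, hb 1 3, hb 2 2, hb 3 1, hb 4 0]
  case hxy =>
    intro s h0 h1
    have hb := bernsteinBasis_nonneg h0 h1
    simp only [sub_zero] at hb
    linarith [hb 0 7, hb 1 6, hb 2 5, hb 3 4, hb 4 3, hb 5 2, hb 6 1, hb 7 0]
  case hκy =>
    intro s h0 h1
    have hb := bernsteinBasis_nonneg h0 h1
    simp only [sub_zero] at hb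
    linarith [hb 0 7, hb 1 6, hb 2 5, hb 3 4, hb 4 3, hb 5 2, hb 6 1, hb 7 0]
  case hE =>
    intro s h0 h1
    have hb := bernsteinBasis_nonneg h0 h1
    simp only [sub_zero] at hb
    push_cast
    linarith [hb 0 10, hb 1 9, hb 2 8, hb 3 7, hb 4 6, hb 5 5, hb 6 4, hb 7 3, hb 8 2, hb 9 1,
      hb 10 0]
  case hxm =>
    intro s h0 h1
    have hb := bernsteinBasis_nonneg h0 h1
    linarith [hb 0 4, hb 1 3, hb 2 2, hb 3 1, hb 4 0]
  have hmiddle := integral_radialIntegrand_middle_nonneg (d := 4) (A := 15) (R := 2) (S := 17 / 5)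
    (s₀ := 4) (σ := 289 / 25) hq hy ?hmid (by norm_num) (by norm_num) (by norm_num)
    (by norm_num) (by norm_num) (by norm_num)
  case hmid =>
    intro s h0 h1
    have hb := bernsteinBasis_nonneg h0 h1
    push_cast
    constructor
    · linarith [hb 0 4, hb 1 3, hb 2 2, hb 3 1, hb 4 0]
    · linarith [hb 0 8, hb 1 7, hb 2 6, hb 3 5, hb 4 4, hb 5 3, hb 6 2, hb 7 1, hb 8 0]
  exact integral_radialIntegrand_pos (γ₂ := 0) (by norm_num) (by norm_num)
    (radialDecay_of_three_le (by norm_num) (by norm_num)) hq (by norm_num)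
    (by norm_num) hcore (by simpa using hmiddle) (by norm_num) (by norm_num) (by norm_num)
    (by norm_num)
    (by norm_num) (by norm_num) hU htail (by norm_num)

/-- Case `d = 5`: at `q = 8` the gain on `[0, R]` is at least `5.7·10⁻³`, and the loss on `[S, ∞)`
at most `4.0·10⁻⁴`. -/
lemma integral_radialIntegrand_pos_five {q : ℝ} (hq : ((8 : ℕ) : ℝ) ≤ q) :
    0 < ∫ r in Set.Ioi (0 : ℝ), radialIntegrand 5 q (18 + (q - (8 : ℕ))) r := by
  have hx : ∀ s : ℝ, 0 ≤ s → 1 - s / 10 + s ^ 2 / 280 - s ^ 3 / 15120 ≤ normBessel 5 s :=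
      fun s hs =>
    le_of_eq_of_le (by
      norm_num [besselPartial, besselCoeff, Finset.sum_range_succ, Finset.prod_range_succ]
      ring)
      (besselPartial_le_normBessel 1 (by norm_num) hs)
  have hy : ∀ s : ℝ, 0 ≤ s → 1 - s / 14 + s ^ 2 / 504 - s ^ 3 / 33264 ≤ normBessel 7 s :=
      fun s hs =>
    le_of_eq_of_le (by
      norm_num [besselPartial, besselCoeff, Finset.sum_range_succ, Finset.prod_range_succ]
      ring)
      (besselPartial_le_normBessel 1 (by norm_num) hs)
  have hU : ∀ s : ℝ, 324 / 25 ≤ s → s ≤ 529 / 25 → |normBessel 5 s| ≤ 9 / 50 := by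
    intro s h0 h1
    have hb := bernsteinBasis_nonneg h0 h1
    have h2 := besselPartial_le_normBessel 1 (d := 5) (by norm_num) (by linarith : 0 ≤ s)
    have h3 := normBessel_le_besselPartial 3 (d := 5) (by norm_num) (by linarith : 0 ≤ s)
    norm_num [besselPartial, besselCoeff, Finset.sum_range_succ, Finset.prod_range_succ] at h2 h3
    refine abs_le.2 ⟨?_, ?_⟩
    · linarith [hb 0 4, hb 1 3, hb 2 2, hb 3 1, hb 4 0]
    · linarith [hb 0 7, hb 1 6, hb 2 5, hb 3 4, hb 4 3, hb 5 2, hb 6 1, hb 7 0]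
  have hul : -37 / 2500 ≤ normBessel 5 (529 / 25) :=
    le_trans (by
        norm_num [besselPartial, besselCoeff, Finset.sum_range_succ, Finset.prod_range_succ])
      (besselPartial_le_normBessel 3 (by norm_num) (by norm_num))
  have huu : normBessel 5 (529 / 25) ≤ -147 / 10000 :=
    le_trans (normBessel_le_besselPartial 4 (by norm_num) (by norm_num))
      (by
        norm_num [besselPartial, besselCoeff, Finset.sum_range_succ, Finset.prod_range_succ])
  have hvl : 713 / 5000 ≤ normBessel 7 (529 / 25) :=
    le_trans (by
        norm_num [besselPartial, besselCoeff, Finset.sum_range_succ, Finset.prod_range_succ])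
      (besselPartial_le_normBessel 3 (by norm_num) (by norm_num))
  have hvu : normBessel 7 (529 / 25) ≤ 1427 / 10000 :=
    le_trans (normBessel_le_besselPartial 4 (by norm_num) (by norm_num))
      (by
        norm_num [besselPartial, besselCoeff, Finset.sum_range_succ, Finset.prod_range_succ])
  have hy₁ : |normBessel 5 (529 / 25) - (529 / 25) / 5 * normBessel 7 (529 / 25)| ≤ 619 / 1000 :=
    abs_le.2 ⟨by linarith, by linarith⟩
  have htail := tail_of_three_le (d := 5) (a := 3) (T := 23 / 5) (τ := 529 / 25) (x := 37 / 2500)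
      (y := 619 / 1000)
    (N := 389 / 1000) (m := 31 / 50) (by norm_num) (by norm_num) (by norm_num) (by norm_num)
    (abs_le.2 ⟨by linarith, by linarith⟩) (by exact_mod_cast hy₁) (by norm_num) (by norm_num)
    (by norm_num)
  have hcore := integral_radialIntegrand_core_of_bounds (d := 5) (p := 8) (A := 18) (R := 9 / 4)
    (κ := 560 / 81) (e := 2 / 5) (r₁ := 9 / 5) (r₂ := 21 / 10) (m := 31 / 50) (s₀ := 81 / 16)
    (s₁ := 81 / 25) (s₂ := 441 / 100)
    (γ := (2 / 5) * (9 / 5) ^ 6 / 5 ^ 2 * (31 / 50) ^ 7 * ((21 / 10) - (9 / 5)))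
    hq hx hy ?hpos ?hxy ?hκy ?hE ?hxm (by norm_num) (by norm_num) (by norm_num) (by norm_num)
    (by norm_num) (by norm_num) (by norm_num) (by norm_num) (by norm_num) (by norm_num)
    (by norm_num)
    (by norm_num) (by norm_num) (by norm_num)
  case hpos =>
    intro s h0 h1
    have hb := bernsteinBasis_nonneg h0 h1
    simp only [sub_zero] at hb
    constructor
    · linarith [hb 0 4, hb 1 3, hb 2 2, hb 3 1, hb 4 0]
    · linarith [hb 0 4, hb 1 3, hb 2 2, hb 3 1, hb 4 0]
  case hxy =>
    intro s h0 h1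
    have hb := bernsteinBasis_nonneg h0 h1
    simp only [sub_zero] at hb
    linarith [hb 0 7, hb 1 6, hb 2 5, hb 3 4, hb 4 3, hb 5 2, hb 6 1, hb 7 0]
  case hκy =>
    intro s h0 h1
    have hb := bernsteinBasis_nonneg h0 h1
    simp only [sub_zero] at hb
    linarith [hb 0 7, hb 1 6, hb 2 5, hb 3 4, hb 4 3, hb 5 2, hb 6 1, hb 7 0]
  case hE =>
    intro s h0 h1
    have hb := bernsteinBasis_nonneg h0 h1
    simp only [sub_zero] at hb
    push_cast
    linarith [hb 0 10, hb 1 9, hb 2 8, hb 3 7, hb 4 6, hb 5 5, hb 6 4, hb 7 3, hb 8 2, hb 9 1,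
      hb 10 0]
  case hxm =>
    intro s h0 h1
    have hb := bernsteinBasis_nonneg h0 h1
    linarith [hb 0 4, hb 1 3, hb 2 2, hb 3 1, hb 4 0]
  have hmiddle := integral_radialIntegrand_middle_nonneg (d := 5) (A := 18) (R := 9 / 4)
      (S := 18 / 5)
    (s₀ := 81 / 16) (σ := 324 / 25) hq hy ?hmid (by norm_num) (by norm_num) (by norm_num)
    (by norm_num) (by norm_num) (by norm_num)
  case hmid =>
    intro s h0 h1
    have hb := bernsteinBasis_nonneg h0 h1
    push_cast
    constructor
    · linarith [hb 0 4, hb 1 3, hb 2 2, hb 3 1, hb 4 0]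
    · linarith [hb 0 8, hb 1 7, hb 2 6, hb 3 5, hb 4 4, hb 5 3, hb 6 2, hb 7 1, hb 8 0]
  exact integral_radialIntegrand_pos (γ₂ := 0) (by norm_num) (by norm_num)
    (radialDecay_of_three_le (by norm_num) (by norm_num)) hq (by norm_num)
    (by norm_num) hcore (by simpa using hmiddle) (by norm_num) (by norm_num) (by norm_num)
    (by norm_num)
    (by norm_num) (by norm_num) hU htail (by norm_num)

/-- Case `d = 6`: at `q = 8` the gain on `[0, R]` is at least `1.4·10⁻²`, and the loss on `[S, ∞)`
at most `8.4·10⁻³`. -/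
lemma integral_radialIntegrand_pos_six {q : ℝ} (hq : ((8 : ℕ) : ℝ) ≤ q) :
    0 < ∫ r in Set.Ioi (0 : ℝ), radialIntegrand 6 q (20 + (q - (8 : ℕ))) r := by
  have hx : ∀ s : ℝ, 0 ≤ s → 1 - s / 12 + s ^ 2 / 384 - s ^ 3 / 23040 ≤ normBessel 6 s :=
      fun s hs =>
    le_of_eq_of_le (by
      norm_num [besselPartial, besselCoeff, Finset.sum_range_succ, Finset.prod_range_succ]
      ring)
      (besselPartial_le_normBessel 1 (by norm_num) hs)
  have hy : ∀ s : ℝ, 0 ≤ s → 1 - s / 16 + s ^ 2 / 640 - s ^ 3 / 46080 ≤ normBessel 8 s :=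
      fun s hs =>
    le_of_eq_of_le (by
      norm_num [besselPartial, besselCoeff, Finset.sum_range_succ, Finset.prod_range_succ]
      ring)
      (besselPartial_le_normBessel 1 (by norm_num) hs)
  have hy' : ∀ s : ℝ, 0 ≤ s → 1 - s / 16 + s ^ 2 / 640 - s ^ 3 / 46080 + s ^ 4 / 5160960 -
      s ^ 5 / 825753600 ≤ normBessel 8 s := fun s hs =>
    le_of_eq_of_le (by
      norm_num [besselPartial, besselCoeff, Finset.sum_range_succ, Finset.prod_range_succ]
      ring)
      (besselPartial_le_normBessel 2 (by norm_num) hs)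
  have hU : ∀ s : ℝ, 5929 / 400 ≤ s → s ≤ 81 / 4 → |normBessel 6 s| ≤ 11 / 50 := by
    intro s h0 h1
    have hb := bernsteinBasis_nonneg h0 h1
    have h2 := besselPartial_le_normBessel 1 (d := 6) (by norm_num) (by linarith : 0 ≤ s)
    have h3 := normBessel_le_besselPartial 2 (d := 6) (by norm_num) (by linarith : 0 ≤ s)
    norm_num [besselPartial, besselCoeff, Finset.sum_range_succ, Finset.prod_range_succ] at h2 h3
    refine abs_le.2 ⟨?_, ?_⟩
    · linarith [hb 0 4, hb 1 3, hb 2 2, hb 3 1, hb 4 0]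
    · linarith [hb 0 5, hb 1 4, hb 2 3, hb 3 2, hb 4 1, hb 5 0]
  have hul : 43 / 500 ≤ normBessel 6 (81 / 4) :=
    le_trans (by
        norm_num [besselPartial, besselCoeff, Finset.sum_range_succ, Finset.prod_range_succ])
      (besselPartial_le_normBessel 3 (by norm_num) (by norm_num))
  have huu : normBessel 6 (81 / 4) ≤ 861 / 10000 :=
    le_trans (normBessel_le_besselPartial 4 (by norm_num) (by norm_num))
      (by
        norm_num [besselPartial, besselCoeff, Finset.sum_range_succ, Finset.prod_range_succ])
  have hvl : 2237 / 10000 ≤ normBessel 8 (81 / 4) :=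
    le_trans (by
        norm_num [besselPartial, besselCoeff, Finset.sum_range_succ, Finset.prod_range_succ])
      (besselPartial_le_normBessel 3 (by norm_num) (by norm_num))
  have hvu : normBessel 8 (81 / 4) ≤ 1119 / 5000 :=
    le_trans (normBessel_le_besselPartial 3 (by norm_num) (by norm_num))
      (by
        norm_num [besselPartial, besselCoeff, Finset.sum_range_succ, Finset.prod_range_succ])
  have hy₁ : |normBessel 6 (81 / 4) - (81 / 4) / 6 * normBessel 8 (81 / 4)| ≤ 67 / 100 :=
    abs_le.2 ⟨by linarith, by linarith⟩
  have htail := tail_of_three_le (d := 6) (a := 2) (T := 9 / 2) (τ := 81 / 4) (x := 861 / 10000)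
      (y := 67 / 100)
    (N := 311 / 500) (m := 27 / 40) (by norm_num) (by norm_num) (by norm_num) (by norm_num)
    (abs_le.2 ⟨by linarith, by linarith⟩) (by exact_mod_cast hy₁) (by norm_num) (by norm_num)
    (by norm_num)
  have hcore := integral_radialIntegrand_core_of_bounds (d := 6) (p := 8) (A := 20) (R := 13 / 5)
    (κ := 1200 / 169) (e := 1 / 2) (r₁ := 17 / 10) (r₂ := 21 / 10) (m := 27 / 40) (s₀ := 169 / 25)
    (s₁ := 289 / 100) (s₂ := 441 / 100)
    (γ := (1 / 2) * (17 / 10) ^ 7 / 6 ^ 2 * (27 / 40) ^ 7 * ((21 / 10) - (17 / 10)))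
    hq hx hy ?hpos ?hxy ?hκy ?hE ?hxm (by norm_num) (by norm_num) (by norm_num) (by norm_num)
    (by norm_num) (by norm_num) (by norm_num) (by norm_num) (by norm_num) (by norm_num)
    (by norm_num)
    (by norm_num) (by norm_num) (by norm_num)
  case hpos =>
    intro s h0 h1
    have hb := bernsteinBasis_nonneg h0 h1
    simp only [sub_zero] at hb
    constructor
    · linarith [hb 0 4, hb 1 3, hb 2 2, hb 3 1, hb 4 0]
    · linarith [hb 0 4, hb 1 3, hb 2 2, hb 3 1, hb 4 0]
  case hxy =>
    intro s h0 h1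
    have hb := bernsteinBasis_nonneg h0 h1
    simp only [sub_zero] at hb
    linarith [hb 0 7, hb 1 6, hb 2 5, hb 3 4, hb 4 3, hb 5 2, hb 6 1, hb 7 0]
  case hκy =>
    intro s h0 h1
    have hb := bernsteinBasis_nonneg h0 h1
    simp only [sub_zero] at hb
    linarith [hb 0 7, hb 1 6, hb 2 5, hb 3 4, hb 4 3, hb 5 2, hb 6 1, hb 7 0]
  case hE =>
    intro s h0 h1
    have hb := bernsteinBasis_nonneg h0 h1
    simp only [sub_zero] at hb
    push_cast
    linarith [hb 0 10, hb 1 9, hb 2 8, hb 3 7, hb 4 6, hb 5 5, hb 6 4, hb 7 3, hb 8 2, hb 9 1,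
      hb 10 0]
  case hxm =>
    intro s h0 h1
    have hb := bernsteinBasis_nonneg h0 h1
    linarith [hb 0 4, hb 1 3, hb 2 2, hb 3 1, hb 4 0]
  have hmiddle := integral_radialIntegrand_middle_nonneg (d := 6) (A := 20) (R := 13 / 5)
      (S := 77 / 20)
    (s₀ := 169 / 25) (σ := 5929 / 400) hq hy' ?hmid (by norm_num) (by norm_num) (by norm_num)
    (by norm_num) (by norm_num) (by norm_num)
  case hmid =>
    intro s h0 h1
    have hb := bernsteinBasis_nonneg h0 h1
    push_cast
    constructor
    · linarith [hb 0 6, hb 1 5, hb 2 4, hb 3 3, hb 4 2, hb 5 1, hb 6 0]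
    · linarith [hb 0 12, hb 1 11, hb 2 10, hb 3 9, hb 4 8, hb 5 7, hb 6 6, hb 7 5, hb 8 4,
        hb 9 3, hb 10 2, hb 11 1, hb 12 0]
  exact integral_radialIntegrand_pos (γ₂ := 0) (by norm_num) (by norm_num)
    (radialDecay_of_three_le (by norm_num) (by norm_num)) hq (by norm_num)
    (by norm_num) hcore (by simpa using hmiddle) (by norm_num) (by norm_num) (by norm_num)
    (by norm_num)
    (by norm_num) (by norm_num) hU htail (by norm_num)

set_option maxHeartbeats 400000 in
/-- Case `d = 7`: at `q = 8` the gain on `[R, S]` is at least `2.1·10⁻¹`, and the loss on `[S, ∞)`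
at most `1.9·10⁻¹`. -/
lemma integral_radialIntegrand_pos_seven {q : ℝ} (hq : ((8 : ℕ) : ℝ) ≤ q) :
    0 < ∫ r in Set.Ioi (0 : ℝ), radialIntegrand 7 q (22 + (q - (8 : ℕ))) r := by
  have hx : ∀ s : ℝ, 0 ≤ s → 1 - s / 14 + s ^ 2 / 504 - s ^ 3 / 33264 ≤ normBessel 7 s :=
      fun s hs =>
    le_of_eq_of_le (by
      norm_num [besselPartial, besselCoeff, Finset.sum_range_succ, Finset.prod_range_succ]
      ring)
      (besselPartial_le_normBessel 1 (by norm_num) hs)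
  have hy : ∀ s : ℝ, 0 ≤ s → 1 - s / 18 + s ^ 2 / 792 - s ^ 3 / 61776 ≤ normBessel 9 s :=
      fun s hs =>
    le_of_eq_of_le (by
      norm_num [besselPartial, besselCoeff, Finset.sum_range_succ, Finset.prod_range_succ]
      ring)
      (besselPartial_le_normBessel 1 (by norm_num) hs)
  have hy' : ∀ s : ℝ, 0 ≤ s → 1 - s / 18 + s ^ 2 / 792 - s ^ 3 / 61776 + s ^ 4 / 7413120 -
      s ^ 5 / 1260230400 ≤ normBessel 9 s := fun s hs =>
    le_of_eq_of_le (by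
      norm_num [besselPartial, besselCoeff, Finset.sum_range_succ, Finset.prod_range_succ]
      ring)
      (besselPartial_le_normBessel 2 (by norm_num) hs)
  have hU : ∀ s : ℝ, 16 ≤ s → s ≤ 2401 / 100 → |normBessel 7 s| ≤ 13 / 50 := by
    intro s h0 h1
    have hb := bernsteinBasis_nonneg h0 h1
    have h2 := besselPartial_le_normBessel 1 (d := 7) (by norm_num) (by linarith : 0 ≤ s)
    have h3 := normBessel_le_besselPartial 3 (d := 7) (by norm_num) (by linarith : 0 ≤ s)
    norm_num [besselPartial, besselCoeff, Finset.sum_range_succ, Finset.prod_range_succ] at h2 h3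
    refine abs_le.2 ⟨?_, ?_⟩
    · linarith [hb 0 4, hb 1 3, hb 2 2, hb 3 1, hb 4 0]
    · linarith [hb 0 7, hb 1 6, hb 2 5, hb 3 4, hb 4 3, hb 5 2, hb 6 1, hb 7 0]
  have hul : 19 / 200 ≤ normBessel 7 (2401 / 100) :=
    le_trans (by
        norm_num [besselPartial, besselCoeff, Finset.sum_range_succ, Finset.prod_range_succ])
      (besselPartial_le_normBessel 3 (by norm_num) (by norm_num))
  have huu : normBessel 7 (2401 / 100) ≤ 951 / 10000 :=
    le_trans (normBessel_le_besselPartial 4 (by norm_num) (by norm_num))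
      (by
        norm_num [besselPartial, besselCoeff, Finset.sum_range_succ, Finset.prod_range_succ])
  have hvl : 209 / 1000 ≤ normBessel 9 (2401 / 100) :=
    le_trans (by
        norm_num [besselPartial, besselCoeff, Finset.sum_range_succ, Finset.prod_range_succ])
      (besselPartial_le_normBessel 3 (by norm_num) (by norm_num))
  have hvu : normBessel 9 (2401 / 100) ≤ 2091 / 10000 :=
    le_trans (normBessel_le_besselPartial 3 (by norm_num) (by norm_num))
      (by
        norm_num [besselPartial, besselCoeff, Finset.sum_range_succ, Finset.prod_range_succ])
  have hy₁ : |normBessel 7 (2401 / 100) - (2401 / 100) / 7 * normBessel 9 (2401 / 100)|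
      ≤ 623 / 1000 :=
    abs_le.2 ⟨by linarith, by linarith⟩
  have htail := tail_of_three_le (d := 7) (a := 1) (T := 49 / 10) (τ := 2401 / 100)
      (x := 951 / 10000) (y := 623 / 1000)
    (N := 321 / 500) (m := 573 / 1000) (by norm_num) (by norm_num) (by norm_num) (by norm_num)
    (abs_le.2 ⟨by linarith, by linarith⟩) (by exact_mod_cast hy₁) (by norm_num) (by norm_num)
    (by norm_num)
  have hcore := integral_radialIntegrand_core_of_bounds (d := 7) (p := 8) (A := 22) (R := 12 / 5)
    (κ := 175 / 16) (e := 0) (r₁ := 0) (r₂ := 0) (m := 573 / 1000) (s₀ := 144 / 25)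
    (s₁ := 0) (s₂ := 0) (γ := 0)
    hq hx hy ?hpos ?hxy ?hκy ?hE ?hxm (by norm_num) (by norm_num) (by norm_num) (by norm_num)
    (by norm_num) (by norm_num) (by norm_num) (by norm_num) (by norm_num) (by norm_num)
    (by norm_num)
    (by norm_num) (by norm_num) (by norm_num)
  case hpos =>
    intro s h0 h1
    have hb := bernsteinBasis_nonneg h0 h1
    simp only [sub_zero] at hb
    constructor
    · linarith [hb 0 4, hb 1 3, hb 2 2, hb 3 1, hb 4 0]
    · linarith [hb 0 4, hb 1 3, hb 2 2, hb 3 1, hb 4 0]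
  case hxy =>
    intro s h0 h1
    have hb := bernsteinBasis_nonneg h0 h1
    simp only [sub_zero] at hb
    linarith [hb 0 7, hb 1 6, hb 2 5, hb 3 4, hb 4 3, hb 5 2, hb 6 1, hb 7 0]
  case hκy =>
    intro s h0 h1
    have hb := bernsteinBasis_nonneg h0 h1
    simp only [sub_zero] at hb
    linarith [hb 0 7, hb 1 6, hb 2 5, hb 3 4, hb 4 3, hb 5 2, hb 6 1, hb 7 0]
  case hE =>
    intro s h0 h1
    have hb := bernsteinBasis_nonneg h0 h1
    simp only [sub_zero] at hb
    push_cast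
    linarith [hb 0 10, hb 1 9, hb 2 8, hb 3 7, hb 4 6, hb 5 5, hb 6 4, hb 7 3, hb 8 2, hb 9 1,
      hb 10 0]
  case hxm =>
    intro s h0 h1
    rw [le_antisymm h1 h0]
    norm_num
  have hy₀ : ∀ s : ℝ, 144 / 25 ≤ s → s ≤ 16 → 0 ≤ 1 - s / 18 + s ^ 2 / 792 - s ^ 3 / 61776 +
      s ^ 4 / 7413120 - s ^ 5 / 1260230400 := by
    intro s h0 h1
    have hb := bernsteinBasis_nonneg h0 h1
    linarith [hb 0 6, hb 1 5, hb 2 4, hb 3 3, hb 4 2, hb 5 1, hb 6 0]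
  have hsq : ∀ s : ℝ, 144 / 25 ≤ s → s ≤ 16 → 22 * s * (1 - s / 18 + s ^ 2 / 792 -
      s ^ 3 / 61776 + s ^ 4 / 7413120 - s ^ 5 / 1260230400) ^ 2 ≤ 22 * s * normBessel 9 s ^ 2
      := by
    intro s h0 h1
    have h2 := hy₀ s h0 h1
    have h3 := hy' s (by linarith)
    have h4 : 0 ≤ s := by linarith
    gcongr
  have hmiddle := integral_radialIntegrand_middle (d := 7) (p := 8) (q := q) (A := 22)
      (R := 12 / 5) (S := 4)
    (g := 33 / 100) (r₁ := 12 / 5) (r₂ := 27 / 10) (m := 573 / 1000) (by norm_num) hq (by norm_num)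
    (by norm_num) ?hmid (by norm_num) (by norm_num) (by norm_num) (by norm_num) ?hum ?hvg
  case hmid =>
    intro s h0 h1
    norm_num only at h0 h1
    have hb := bernsteinBasis_nonneg h0 h1
    have h2 := hsq s h0 h1
    push_cast
    linarith [hb 0 12, hb 1 11, hb 2 10, hb 3 9, hb 4 8, hb 5 7, hb 6 6, hb 7 5, hb 8 4,
      hb 9 3, hb 10 2, hb 11 1, hb 12 0, h2]
  case hum =>
    intro s h0 h1
    norm_num only at h0 h1
    have hb := bernsteinBasis_nonneg h0 h1
    have h2 := hx s (by linarith)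
    linarith [hb 0 4, hb 1 3, hb 2 2, hb 3 1, hb 4 0, h2]
  case hvg =>
    intro s h0 h1
    norm_num only at h0 h1
    have hb := bernsteinBasis_nonneg h0 h1
    have h2 := hsq s h0 (by linarith)
    push_cast
    linarith [hb 0 12, hb 1 11, hb 2 10, hb 3 9, hb 4 8, hb 5 7, hb 6 6, hb 7 5, hb 8 4,
      hb 9 3, hb 10 2, hb 11 1, hb 12 0, h2]
  exact integral_radialIntegrand_pos (by norm_num) (by norm_num)
    (radialDecay_of_three_le (by norm_num) (by norm_num)) hq (by norm_num)
    (by norm_num) hcore hmiddle (by norm_num) (by norm_num) (by norm_num) (by norm_num)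
    (by norm_num) (by norm_num) hU htail (by norm_num)

end SphereExtension

theorem mainTheorem7 (d : ℕ) (hd2 : 2 ≤ d) (hd7 : d ≤ 7) (q : ℝ)
    (hq : SphereExtension.qStar d ≤ q) :
    MemLp (SphereExtension.extension d (SphereExtension.one d)) (ENNReal.ofReal q) volume ∧
    MemLp (SphereExtension.extension d (SphereExtension.one d)) (ENNReal.ofReal (q + 2)) volume ∧
    SphereExtension.Phi d (q + 2) (SphereExtension.one d) >
      SphereExtension.gam d q * SphereExtension.Phi d q (SphereExtension.one d) := by
  have hd1 : 1 ≤ d := by omega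
  obtain ⟨p, hp, hdec, hpq, hpos⟩ : ∃ p : ℕ, 2 ≤ p ∧ SphereExtension.RadialDecay d p ∧
      (p : ℝ) ≤ q ∧ 0 < ∫ r in Set.Ioi (0 : ℝ), SphereExtension.radialIntegrand d q
        (2 * (d : ℝ) + q - (if d = 4 then 1 else 0)) r := by
    have h3 : 3 ≤ d → SphereExtension.RadialDecay d 8 := fun h =>
      SphereExtension.radialDecay_of_three_le h hd7
    unfold SphereExtension.qStar at hq
    interval_cases d <;> norm_num only [if_true, if_false] at hq h3
    · refine ⟨12, by norm_num, SphereExtension.radialDecay_two, by exact_mod_cast hq, ?_⟩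
      convert SphereExtension.integral_radialIntegrand_pos_two (by exact_mod_cast hq) using 4
      norm_num
      ring
    · refine ⟨8, by norm_num, h3 trivial, by exact_mod_cast hq, ?_⟩
      convert SphereExtension.integral_radialIntegrand_pos_three (by exact_mod_cast hq) using 4
      norm_num
      ring
    · refine ⟨8, by norm_num, h3 trivial, by exact_mod_cast hq, ?_⟩
      convert SphereExtension.integral_radialIntegrand_pos_four (by exact_mod_cast hq) using 4
      norm_num
      ring
    · refine ⟨8, by norm_num, h3 trivial, by exact_mod_cast hq, ?_⟩
      convert SphereExtension.integral_radialIntegrand_pos_five (by exact_mod_cast hq) using 4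
      norm_num
      ring
    · refine ⟨8, by norm_num, h3 trivial, by exact_mod_cast hq, ?_⟩
      convert SphereExtension.integral_radialIntegrand_pos_six (by exact_mod_cast hq) using 4
      norm_num
      ring
    · refine ⟨8, by norm_num, h3 trivial, by exact_mod_cast hq, ?_⟩
      convert SphereExtension.integral_radialIntegrand_pos_seven (by exact_mod_cast hq) using 4
      norm_num
      ring
  have hp' : (2 : ℝ) ≤ p := by exact_mod_cast hp
  have hd' : (2 : ℝ) ≤ d := by exact_mod_cast hd2
  have hA : 0 < 2 * (d : ℝ) + q - (if d = 4 then 1 else 0) := by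
    split_ifs <;> linarith
  exact ⟨SphereExtension.memLp_extension_one hd1 (by omega) hdec hpq,
    SphereExtension.memLp_extension_one hd1 (by omega) hdec (by linarith),
    SphereExtension.Phi_one_lt_of_integral_pos hd1 hp hdec hpq hA hpos⟩
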